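/- **Definitions.** An *algebraic theory* $\mathcal T$ is a functor $n\mapsto\mathcal T(n)$ from the skeleton of finite sets $\{1,\dots,n\}$, $n\ge 0$ (all functions as maps) to sets, with projections $\mathrm{pr}_1,\dots,\mathrm{pr}_n\in\mathcal T(n)$ and compositions $\mathcal T(n)\times\mathcal T(m)^n\to\mathcal T(m)$ that are associative, unital, compatible with the projections and natural in $n$ and $m$; maps of theories are natural transformations preserving projections and composition. A *$\mathcal T$-algebra* is a set $A$ with an associative, unital action $\mathcal T(n)\times A^n\to A$, natural in $n$; homomorphisms respect the actions. Composition makes $\mathcal T(0)$ a $\mathcal T$-algebra, the initial one. A *$\lambda$-theory* is an algebraic theory $\mathcal L$ with maps $\rho:\mathcal L(n)\to\mathcal L(n+1)$ and $\lambda:\mathcal L(n+1)\to\mathcal L(n)$ such that $\rho\circ\lambda=\mathrm{id}$, natural in $n$ and compatible with the substitution actions $\mathcal L(m)\times\mathcal L(n)^m\to\mathcal L(n)$ and $\mathcal L(m+1)\times\mathcal L(n)^m\to\mathcal L(n+1)$ (the latter leaving the last variable undisturbed). Maps of $\lambda$-theories are maps of algebraic theories commuting with $\rho$ and $\lambda$.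 The initial $\lambda$-theory $\Lambda$ has as $\Lambda(n)$ the untyped $\lambda$-terms in $n$ free variables modulo $\beta$-equality, with substitution as composition, $\rho(t)=tz$ and $\lambda(s)=\lambda z.s$, where $z$ is the last variable. A *$\Lambda$-algebra* is an algebra for $\Lambda$. For a $\lambda$-theory $\mathcal L$, the set $\mathcal L(0)$ is a $\Lambda$-algebra by restricting the initial $\mathcal L$-algebra along the unique map $\Lambda\to\mathcal L$; this gives a functor from $\lambda$-theories to $\Lambda$-algebras. For a theory $\mathcal S$ and an $\mathcal S$-algebra $A$, the *theory of extensions* $\mathcal S_A$ is the algebraic theory obtained from $\mathcal S$ by adding a constant for each element of $A$ and the equations holding in $A$, and no others; so $\mathcal S_A(n)$ is the free extension $A+\mathcal S(n)$ of $A$ by $n$ indeterminates. It is functorial in $A$, and there are canonical maps $\mathcal S\to\mathcal S_A$ and $A\to\mathcal S_A(0)$. For a map of theories $F:\mathcal S\to\mathcal T$, with $A=\mathcal T(0)$ regarded as an $\mathcal S$-algebra via $F$, there is a comparison map $\mathcal S_A\to\mathcal T$ through which $F$ factors; $\mathcal T$ is called the theory of extensions of the model $A$ of $\mathcal S$ if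 the comparison map is an isomorphism of theories. **Theorem (Fundamental Theorem of the $\lambda$-calculus).** The theories of extensions $\Lambda_A$ of $\Lambda$-algebras $A$ carry $\lambda$-theory structures such that $\Lambda\to\Lambda_A$ is a map of $\lambda$-theories for every $A$ and the induced map $\Lambda_A\to\Lambda_B$ is a map of $\lambda$-theories for every homomorphism $A\to B$. With the resulting functor $A\mapsto\Lambda_A$, the functors $\mathcal L\mapsto\mathcal L(0)$ and $A\mapsto\Lambda_A$ form an adjoint equivalence between the category of $\lambda$-theories and the category of $\Lambda$-algebras: $\mathcal L\mapsto\mathcal L(0)$ is left adjoint to $A\mapsto\Lambda_A$, and the unit and counit are natural isomorphisms $\mathcal L\cong\Lambda_{\mathcal L(0)}$ and $\Lambda_A(0)\cong A$, inverse respectively to the comparison map $\Lambda_{\mathcal L(0)}\to\mathcal L$ and to the canonical map $A\to\Lambda_A(0)$. In particular, every $\lambda$-theory $\mathcal L$ is the theory of extensions of its initial algebra $\mathcal L(0)$, regarded as a $\Lambda$-algebra. -/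

import Mathlib

open CategoryTheory

universe u

namespace LambdaCalc

/-! ## Algebraic theories (cartesian operads) -/

/-- An algebraic theory: a functor `n ↦ Op n` from the skeleton of finite sets (objects `Fin n`,
all functions as maps) to sets, with projections and compositions. -/
structure AlgTheory : Type (u + 1) where
  /-- the set of `n`-ary multimaps -/
  Op : ℕ → Type u
  /-- variable renaming -/
  map : ∀ {m n : ℕ}, (Fin m → Fin n) → Op m → Op n
  pr : ∀ {n : ℕ}, Fin n → Op n
  comp : ∀ {n m : ℕ}, Op n → (Fin n → Op m) → Op m
  map_id : ∀ {n : ℕ} (t : Op n), map id t = t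
  map_map : ∀ {l m n : ℕ} (f : Fin l → Fin m) (g : Fin m → Fin n) (t : Op l),
    map g (map f t) = map (g ∘ f) t
  map_pr : ∀ {m n : ℕ} (f : Fin m → Fin n) (i : Fin m), map f (pr i) = pr (f i)
  pr_comp : ∀ {n m : ℕ} (i : Fin n) (s : Fin n → Op m), comp (pr i) s = s i
  comp_pr : ∀ {n : ℕ} (t : Op n), comp t pr = t
  comp_assoc : ∀ {l m n : ℕ} (t : Op l) (s : Fin l → Op m) (r : Fin m → Op n),
    comp (comp t s) r = comp t (fun i => comp (s i) r)
  /-- naturality (dinaturality) in the arity of the outer operation -/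
  map_comp_left : ∀ {l m n : ℕ} (f : Fin l → Fin m) (t : Op l) (s : Fin m → Op n),
    comp (map f t) s = comp t (s ∘ f)
  /-- naturality in the common arity of the inner operations -/
  map_comp_right : ∀ {l m n : ℕ} (g : Fin m → Fin n) (t : Op l) (s : Fin l → Op m),
    comp t (fun i => map g (s i)) = map g (comp t s)

/-- The map `Fin (m + 1) → Fin (n + 1)` that is `f` on the old variables and sends the new, last
variable to the new, last variable. -/
def liftRen {m n : ℕ} (f : Fin m → Fin n) : Fin (m + 1) → Fin (n + 1) :=
  Fin.snoc (α := fun _ => Fin (n + 1)) (fun i => (f i).castSucc) (Fin.last n)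

namespace AlgTheory

/-- Extend a tuple over `n` variables to one over `n + 1` variables, leaving the extra variable
undisturbed: `(s₁, …, sₘ) ↦ (s₁, …, sₘ, z)`. -/
def lift (T : AlgTheory.{u}) {m n : ℕ} (s : Fin m → T.Op n) : Fin (m + 1) → T.Op (n + 1) :=
  Fin.snoc (α := fun _ => T.Op (n + 1)) (fun i => T.map Fin.castSucc (s i)) (T.pr (Fin.last n))

theorem map_eq_comp (T : AlgTheory.{u}) {m n : ℕ} (f : Fin m → Fin n) (t : T.Op m) :
    T.map f t = T.comp t (fun i => T.pr (f i)) := by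
  rw [← T.comp_pr (T.map f t), T.map_comp_left]; rfl

/-- Maps of algebraic theories. -/
@[ext]
structure Hom (S T : AlgTheory.{u}) : Type u where
  app : ∀ {n : ℕ}, S.Op n → T.Op n
  app_map : ∀ {m n : ℕ} (f : Fin m → Fin n) (t : S.Op m), app (S.map f t) = T.map f (app t)
  app_pr : ∀ {n : ℕ} (i : Fin n), app (S.pr i) = T.pr i
  app_comp : ∀ {n m : ℕ} (t : S.Op n) (s : Fin n → S.Op m),
    app (S.comp t s) = T.comp (app t) (fun i => app (s i))

instance : Category AlgTheory.{u} where
  Hom := Hom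
  id T := ⟨fun t => t, fun _ _ => rfl, fun _ => rfl, fun _ _ => rfl⟩
  comp F G := ⟨fun t => G.app (F.app t), fun f t => by rw [F.app_map, G.app_map],
    fun i => by rw [F.app_pr, G.app_pr], fun t s => by rw [F.app_comp, G.app_comp]⟩

theorem hom_ext {S T : AlgTheory.{u}} {F G : S ⟶ T}
    (h : ∀ (n : ℕ) (t : S.Op n), F.app t = G.app t) : F = G := by
  apply Hom.ext
  funext n t
  exact h n t

/-! ## Algebras for an algebraic theory -/

/-- Algebras for an algebraic theory `T`. -/
structure Alg (T : AlgTheory.{u}) : Type (u + 1) where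
  carrier : Type u
  act : ∀ {n : ℕ}, T.Op n → (Fin n → carrier) → carrier
  act_pr : ∀ {n : ℕ} (i : Fin n) (a : Fin n → carrier), act (T.pr i) a = a i
  act_comp : ∀ {n m : ℕ} (t : T.Op n) (s : Fin n → T.Op m) (a : Fin m → carrier),
    act (T.comp t s) a = act t (fun i => act (s i) a)
  act_map : ∀ {m n : ℕ} (f : Fin m → Fin n) (t : T.Op m) (a : Fin n → carrier),
    act (T.map f t) a = act t (a ∘ f)

/-- Homomorphisms of algebras. -/
@[ext]
structure Alg.Hom {T : AlgTheory.{u}} (A B : Alg T) : Type u where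
  toFun : A.carrier → B.carrier
  map_act : ∀ {n : ℕ} (t : T.Op n) (a : Fin n → A.carrier),
    toFun (A.act t a) = B.act t (fun i => toFun (a i))

instance (T : AlgTheory.{u}) : Category (Alg T) where
  Hom := Alg.Hom
  id A := ⟨fun a => a, fun _ _ => rfl⟩
  comp f g := ⟨fun a => g.toFun (f.toFun a), fun t a => by rw [f.map_act, g.map_act]⟩

/-- The algebra structure on `T(n)` given by composition. -/
def freeAlg (T : AlgTheory.{u}) (n : ℕ) : Alg T where
  carrier := T.Op n
  act t a := T.comp t a
  act_pr := T.pr_comp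
  act_comp := T.comp_assoc
  act_map := T.map_comp_left

/-- `T(0)` is the initial `T`-algebra. -/
def freeAlgZeroIsInitial (T : AlgTheory.{u}) : Limits.IsInitial (T.freeAlg 0) :=
  Limits.IsInitial.ofUniqueHom
    (fun A => ⟨fun t => A.act t Fin.elim0, fun t a => A.act_comp t a _⟩)
    (fun A f => by
      apply Alg.Hom.ext
      funext t
      change f.toFun t = A.act t Fin.elim0
      have h := f.map_act t (fun i : Fin 0 => i.elim0)
      have h1 : (T.freeAlg 0).act t (fun i : Fin 0 => i.elim0) = t := by
        change T.comp t _ = t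
        conv_rhs => rw [← T.comp_pr t]
        congr 1
        funext i
        exact i.elim0
      rw [h1] at h
      rw [h]
      congr 1
      funext i
      exact i.elim0)

/-- Restriction of a `T`-algebra along a map of theories `F : S ⟶ T`. -/
def Alg.restrict {S T : AlgTheory.{u}} (F : S ⟶ T) (B : Alg T) : Alg S where
  carrier := B.carrier
  act t a := B.act (F.app t) a
  act_pr i a := by rw [F.app_pr, B.act_pr]
  act_comp t s a := by rw [F.app_comp, B.act_comp]
  act_map f t a := by rw [F.app_map, B.act_map]

/-! ## The theory of extensions of an algebra -/

/-- Formal terms in `n` variables built from the operations of `S` and a constant for each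
element of the algebra `A`. -/
inductive ExtTm (S : AlgTheory.{u}) (A : Alg S) (n : ℕ) : Type u
  | var (i : Fin n) : ExtTm S A n
  | const (a : A.carrier) : ExtTm S A n
  | op {k : ℕ} (t : S.Op k) (args : Fin k → ExtTm S A n) : ExtTm S A n

/-- The congruence generated by the equations of `S` and the equations that hold in `A`. -/
inductive ExtRel (S : AlgTheory.{u}) (A : Alg S) {n : ℕ} : ExtTm S A n → ExtTm S A n → Prop
  | refl (x : ExtTm S A n) : ExtRel S A x x
  | symm {x y : ExtTm S A n} : ExtRel S A x y → ExtRel S A y x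
  | trans {x y z : ExtTm S A n} : ExtRel S A x y → ExtRel S A y z → ExtRel S A x z
  | congr {k : ℕ} (t : S.Op k) {x y : Fin k → ExtTm S A n} :
      (∀ i, ExtRel S A (x i) (y i)) → ExtRel S A (.op t x) (.op t y)
  | op_pr {k : ℕ} (i : Fin k) (x : Fin k → ExtTm S A n) : ExtRel S A (.op (S.pr i) x) (x i)
  | op_comp {k l : ℕ} (t : S.Op k) (s : Fin k → S.Op l) (x : Fin l → ExtTm S A n) :
      ExtRel S A (.op (S.comp t s) x) (.op t (fun i => .op (s i) x))
  | op_const {k : ℕ} (t : S.Op k) (a : Fin k → A.carrier) :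
      ExtRel S A (.op t (fun i => .const (a i))) (.const (A.act t a))

namespace ExtTm

variable {S : AlgTheory.{u}} {A B : Alg S}

/-- Simultaneous substitution for the variables. -/
def subst {n m : ℕ} (σ : Fin n → ExtTm S A m) : ExtTm S A n → ExtTm S A m
  | var i => σ i
  | const a => const a
  | op t x => op t (fun i => subst σ (x i))

/-- Apply a homomorphism to the constants. -/
def mapConst (f : A ⟶ B) {n : ℕ} : ExtTm S A n → ExtTm S B n
  | var i => var i
  | const a => const (f.toFun a)
  | op t x => op t (fun i => mapConst f (x i))

theorem subst_subst {l m n : ℕ} (σ : Fin l → ExtTm S A m) (τ : Fin m → ExtTm S A n)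
    (x : ExtTm S A l) : subst τ (subst σ x) = subst (fun i => subst τ (σ i)) x := by
  induction x with
  | var i => rfl
  | const a => rfl
  | op t x ih => simp only [subst, ih]

theorem subst_var {n : ℕ} (x : ExtTm S A n) : subst var x = x := by
  induction x with
  | var i => rfl
  | const a => rfl
  | op t x ih => simp only [subst, ih]

theorem mapConst_subst (f : A ⟶ B) {m n : ℕ} (σ : Fin m → ExtTm S A n) (x : ExtTm S A m) :
    mapConst f (subst σ x) = subst (fun i => mapConst f (σ i)) (mapConst f x) := by
  induction x with
  | var i => rfl
  | const a => rfl
  | op t x ih => simp only [subst, mapConst, ih]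

theorem rel_subst {m n : ℕ} (σ : Fin m → ExtTm S A n) {x y : ExtTm S A m}
    (h : ExtRel S A x y) : ExtRel S A (subst σ x) (subst σ y) := by
  induction h with
  | refl x => exact .refl _
  | symm _ ih => exact ih.symm
  | trans _ _ ih₁ ih₂ => exact ih₁.trans ih₂
  | congr t _ ih => exact .congr t ih
  | op_pr i x => exact .op_pr i _
  | op_comp t s x => exact .op_comp t s _
  | op_const t a => exact .op_const t a

theorem subst_rel {m n : ℕ} {σ τ : Fin m → ExtTm S A n} (h : ∀ i, ExtRel S A (σ i) (τ i))
    (x : ExtTm S A m) : ExtRel S A (subst σ x) (subst τ x) := by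
  induction x with
  | var i => exact h i
  | const a => exact .refl _
  | op t x ih => exact .congr t ih

theorem mapConst_rel (f : A ⟶ B) {n : ℕ} {x y : ExtTm S A n}
    (h : ExtRel S A x y) : ExtRel S B (mapConst f x) (mapConst f y) := by
  induction h with
  | refl x => exact .refl _
  | symm _ ih => exact ih.symm
  | trans _ _ ih₁ ih₂ => exact ih₁.trans ih₂
  | congr t _ ih => exact .congr t ih
  | op_pr i x => exact .op_pr i _
  | op_comp t s x => exact .op_comp t s _
  | op_const t a =>
    simp only [mapConst]
    rw [f.map_act]
    exact .op_const t _

end ExtTm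

/-- `ExtRel` as a setoid. -/
def extSetoid (S : AlgTheory.{u}) (A : Alg S) (n : ℕ) : Setoid (ExtTm S A n) :=
  ⟨ExtRel S A, .refl, .symm, .trans⟩

/-- The underlying set of the free extension `A[n]` of `A` by `n` indeterminates, presented by
generators (the elements of `A` and `n` indeterminates) and relations (those of `A`). -/
def ExtOp (S : AlgTheory.{u}) (A : Alg S) (n : ℕ) : Type u := Quotient (extSetoid S A n)

/-- The class of a formal term. -/
def ExtOp.mk {S : AlgTheory.{u}} {A : Alg S} {n : ℕ} (x : ExtTm S A n) : ExtOp S A n :=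
  Quotient.mk (extSetoid S A n) x

namespace ExtOp

variable {S : AlgTheory.{u}} {A B : Alg S}

theorem sound {n : ℕ} {x y : ExtTm S A n} (h : ExtRel S A x y) : mk x = mk y :=
  Quotient.sound h

theorem exists_rep {n : ℕ} (x : ExtOp S A n) : ∃ y, mk y = x := Quotient.exists_rep x

theorem exists_reps {k n : ℕ} (x : Fin k → ExtOp S A n) : ∃ y : Fin k → ExtTm S A n,
    x = fun i => mk (y i) := by
  choose y hy using fun i => exists_rep (x i)
  exact ⟨y, funext fun i => (hy i).symm⟩

/-- Substitution on classes. -/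
noncomputable def comp {n m : ℕ} (x : ExtOp S A n) (σ : Fin n → ExtOp S A m) : ExtOp S A m :=
  Quotient.lift (fun x => mk (ExtTm.subst (fun i => Quotient.out (σ i)) x))
    (fun _ _ h => sound (ExtTm.rel_subst _ h)) x

theorem comp_mk {n m : ℕ} (x : ExtTm S A n) (σ : Fin n → ExtTm S A m) :
    comp (mk x) (fun i => mk (σ i)) = mk (ExtTm.subst σ x) :=
  sound (ExtTm.subst_rel (fun i => Quotient.exact (Quotient.out_eq (mk (σ i)))) x)

/-- Renaming of variables on classes. -/
def map {n m : ℕ} (f : Fin n → Fin m) (x : ExtOp S A n) : ExtOp S A m :=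
  Quotient.lift (fun x => mk (ExtTm.subst (fun i => .var (f i)) x))
    (fun _ _ h => sound (ExtTm.rel_subst _ h)) x

/-- Apply a homomorphism to the constants. -/
def mapConst (f : A ⟶ B) {n : ℕ} (x : ExtOp S A n) : ExtOp S B n :=
  Quotient.lift (fun x => mk (ExtTm.mapConst f x))
    (fun _ _ h => sound (ExtTm.mapConst_rel f h)) x

end ExtOp

/-- The theory `S_A` of extensions of the `S`-algebra `A`: it is obtained from `S` by adding
constants for the elements of `A`, and the equations coming from `A` but no other equations. -/
noncomputable def ext (S : AlgTheory.{u}) (A : Alg S) : AlgTheory.{u} where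
  Op := ExtOp S A
  map := ExtOp.map
  pr i := ExtOp.mk (.var i)
  comp := ExtOp.comp
  map_id t := by
    obtain ⟨t, rfl⟩ := ExtOp.exists_rep t
    exact congrArg ExtOp.mk (ExtTm.subst_var t)
  map_map f g t := by
    obtain ⟨t, rfl⟩ := ExtOp.exists_rep t
    exact congrArg ExtOp.mk (ExtTm.subst_subst _ _ t)
  map_pr f i := rfl
  pr_comp i s := by
    obtain ⟨s, rfl⟩ := ExtOp.exists_reps s
    exact ExtOp.comp_mk _ _
  comp_pr t := by
    obtain ⟨t, rfl⟩ := ExtOp.exists_rep t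
    rw [ExtOp.comp_mk, ExtTm.subst_var]
  comp_assoc t s r := by
    obtain ⟨t, rfl⟩ := ExtOp.exists_rep t
    obtain ⟨s, rfl⟩ := ExtOp.exists_reps s
    obtain ⟨r, rfl⟩ := ExtOp.exists_reps r
    simp only [ExtOp.comp_mk, ExtTm.subst_subst]
  map_comp_left f t s := by
    obtain ⟨t, rfl⟩ := ExtOp.exists_rep t
    obtain ⟨s, rfl⟩ := ExtOp.exists_reps s
    refine (ExtOp.comp_mk (ExtTm.subst _ t) s).trans ?_
    rw [ExtTm.subst_subst]
    exact (ExtOp.comp_mk t (s ∘ f)).symm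
  map_comp_right g t s := by
    obtain ⟨t, rfl⟩ := ExtOp.exists_rep t
    obtain ⟨s, rfl⟩ := ExtOp.exists_reps s
    rw [ExtOp.comp_mk]
    refine (ExtOp.comp_mk t _).trans ?_
    exact congrArg ExtOp.mk (ExtTm.subst_subst s _ t).symm

/-- The map `S_A ⟶ S_B` induced by a homomorphism `A ⟶ B`. -/
noncomputable def extMap (S : AlgTheory.{u}) {A B : Alg S} (f : A ⟶ B) :
    S.ext A ⟶ S.ext B where
  app := ExtOp.mapConst f
  app_map g t := by
    obtain ⟨t, rfl⟩ := ExtOp.exists_rep t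
    exact congrArg ExtOp.mk (ExtTm.mapConst_subst f _ t)
  app_pr i := rfl
  app_comp t s := by
    obtain ⟨t, rfl⟩ := ExtOp.exists_rep t
    obtain ⟨s, rfl⟩ := ExtOp.exists_reps s
    refine (congrArg (ExtOp.mapConst f) (ExtOp.comp_mk t s)).trans ?_
    refine (congrArg ExtOp.mk (ExtTm.mapConst_subst f s t)).trans ?_
    exact (ExtOp.comp_mk (ExtTm.mapConst f t) (fun i => ExtTm.mapConst f (s i))).symm

theorem extMap_id (S : AlgTheory.{u}) (A : Alg S) : S.extMap (𝟙 A) = 𝟙 (S.ext A) := by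
  apply hom_ext
  intro n t
  obtain ⟨t, rfl⟩ := ExtOp.exists_rep t
  refine congrArg ExtOp.mk ?_
  induction t with
  | var i => rfl
  | const a => rfl
  | op t x ih => simp only [ExtTm.mapConst, ih]

theorem extMap_comp (S : AlgTheory.{u}) {A B C : Alg S} (f : A ⟶ B) (g : B ⟶ C) :
    S.extMap (f ≫ g) = S.extMap f ≫ S.extMap g := by
  apply hom_ext
  intro n t
  obtain ⟨t, rfl⟩ := ExtOp.exists_rep t
  refine congrArg ExtOp.mk ?_
  induction t with
  | var i => rfl
  | const a => rfl
  | op t x ih => simp only [ExtTm.mapConst, ih]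

/-- The map of theories `S ⟶ S_A`. -/
noncomputable def extIncl (S : AlgTheory.{u}) (A : Alg S) : S ⟶ S.ext A where
  app t := ExtOp.mk (.op t .var)
  app_map f t := by
    rw [S.map_eq_comp]
    refine ExtOp.sound ((ExtRel.op_comp t _ _).trans (.congr t fun i => ?_))
    exact .op_pr _ _
  app_pr i := ExtOp.sound (.op_pr i _)
  app_comp t s := by
    refine (ExtOp.sound (ExtRel.op_comp t s _)).trans ?_
    exact (ExtOp.comp_mk (.op t .var) (fun i => .op (s i) .var)).symm

/-- The constants of `S_A`, as a homomorphism of `S`-algebras `A ⟶ S_A(0)`. -/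
noncomputable def extConst (S : AlgTheory.{u}) (A : Alg S) :
    A ⟶ Alg.restrict (S.extIncl A) ((S.ext A).freeAlg 0) where
  toFun a := ExtOp.mk (.const a)
  map_act t a := by
    refine (ExtOp.sound (ExtRel.op_const t a).symm).trans ?_
    exact (ExtOp.comp_mk (.op t .var) (fun i => .const (a i))).symm

/-- `S_A(n)` is the free extension of `A` by `n` indeterminates, i.e. the coproduct `A + S(n)`. -/
theorem ext_free (S : AlgTheory.{u}) (A B : Alg S) (n : ℕ) (g : A ⟶ B)
    (b : Fin n → B.carrier) :
    ∃! h : Alg.restrict (S.extIncl A) ((S.ext A).freeAlg n) ⟶ B,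
      (∀ a : A.carrier, h.toFun (ExtOp.mk (.const a)) = g.toFun a) ∧
      ∀ i : Fin n, h.toFun (ExtOp.mk (.var i)) = b i := by
  let ev : ExtTm S A n → B.carrier := fun x =>
    ExtTm.rec (motive := fun _ => B.carrier) b g.toFun (fun t _ ih => B.act t ih) x
  have hev : ∀ x y : ExtTm S A n, ExtRel S A x y → ev x = ev y := by
    intro x y h
    induction h with
    | refl x => rfl
    | symm _ ih => exact ih.symm
    | trans _ _ ih₁ ih₂ => exact ih₁.trans ih₂
    | congr t _ ih => exact congrArg (B.act t) (funext ih)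
    | op_pr i x => exact B.act_pr i _
    | op_comp t s x => exact B.act_comp t s _
    | op_const t a => exact (g.map_act t a).symm
  refine ⟨⟨Quotient.lift ev hev, fun t a => ?_⟩, ⟨fun a => rfl, fun i => rfl⟩, ?_⟩
  · obtain ⟨a, rfl⟩ := ExtOp.exists_reps a
    exact congrArg (Quotient.lift ev hev) (ExtOp.comp_mk (.op t .var) a)
  · rintro h ⟨h₁, h₂⟩
    apply Alg.Hom.ext
    funext x
    obtain ⟨x, rfl⟩ := ExtOp.exists_rep x
    change h.toFun (ExtOp.mk x) = ev x
    induction x with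
    | var i => exact h₂ i
    | const a => exact h₁ a
    | op t x ih =>
      refine (congrArg h.toFun (ExtOp.comp_mk (.op t .var) x).symm).trans ?_
      exact (h.map_act t (fun i => ExtOp.mk (x i))).trans (congrArg (B.act t) (funext ih))

section Comparison

variable {S T : AlgTheory.{u}} (F : S ⟶ T)

/-- Evaluation in `T` of the terms with constants from `T(0)`. -/
def comparisonTm {n : ℕ} : ExtTm S (Alg.restrict F (T.freeAlg 0)) n → T.Op n
  | .var i => T.pr i
  | .const a => T.map (m := 0) Fin.elim0 a
  | .op t x => T.comp (F.app t) (fun i => comparisonTm (x i))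

theorem comparisonTm_rel {n : ℕ} {x y : ExtTm S (Alg.restrict F (T.freeAlg 0)) n}
    (h : ExtRel S _ x y) : comparisonTm F x = comparisonTm F y := by
  induction h with
  | refl x => rfl
  | symm _ ih => exact ih.symm
  | trans _ _ ih₁ ih₂ => exact ih₁.trans ih₂
  | congr t _ ih => simp only [comparisonTm, ih]
  | op_pr i x => simp only [comparisonTm, F.app_pr, T.pr_comp]
  | op_comp t s x => simp only [comparisonTm, F.app_comp, T.comp_assoc]
  | op_const t a => exact T.map_comp_right (m := 0) Fin.elim0 (F.app t) a

theorem comparisonTm_subst {n m : ℕ} (σ : Fin n → ExtTm S (Alg.restrict F (T.freeAlg 0)) m)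
    (x : ExtTm S (Alg.restrict F (T.freeAlg 0)) n) :
    comparisonTm F (ExtTm.subst σ x) = T.comp (comparisonTm F x)
      (fun i => comparisonTm F (σ i)) := by
  induction x with
  | var i => simp only [comparisonTm, ExtTm.subst, T.pr_comp]
  | const a =>
    refine (T.map_eq_comp _ _).trans (Eq.trans ?_ (T.map_comp_left _ _ _).symm)
    congr 1
    funext i
    exact i.elim0
  | op t x ih => simp only [comparisonTm, ExtTm.subst, T.comp_assoc, ih]

/-- For a map of theories `F : S ⟶ T` and `A = T(0)` as an `S`-algebra, the comparison
`S_A ⟶ T` through which `F` factors. -/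
noncomputable def comparison : S.ext (Alg.restrict F (T.freeAlg 0)) ⟶ T where
  app x := Quotient.lift (comparisonTm F) (fun _ _ h => comparisonTm_rel F h) x
  app_map f t := by
    obtain ⟨t, rfl⟩ := ExtOp.exists_rep t
    refine (comparisonTm_subst F _ t).trans ?_
    exact (T.map_eq_comp f _).symm
  app_pr i := rfl
  app_comp t s := by
    obtain ⟨t, rfl⟩ := ExtOp.exists_rep t
    obtain ⟨s, rfl⟩ := ExtOp.exists_reps s
    refine Eq.trans ?_ (comparisonTm_subst F s t)
    exact congrArg (Quotient.lift (comparisonTm F) (fun _ _ h => comparisonTm_rel F h))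
      (ExtOp.comp_mk t s)

theorem extIncl_comparison : S.extIncl _ ≫ comparison F = F := by
  apply hom_ext
  intro n t
  exact T.comp_pr (F.app t)

/-- `F : S ⟶ T` exhibits `T` as the theory of extensions of a model of `S` (namely of `T(0)`). -/
def IsTheoryOfExtensions : Prop := IsIso (comparison F)

end Comparison

/-! ## Semi-closed structure and `λ`-theories -/

/-- Semi-closed structure on an algebraic theory. -/
@[ext]
structure SemiClosed (L : AlgTheory.{u}) : Type u where
  /-- the retraction -/
  rho : ∀ {n : ℕ}, L.Op n → L.Op (n + 1)
  /-- the section -/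
  lam : ∀ {n : ℕ}, L.Op (n + 1) → L.Op n
  rho_lam : ∀ {n : ℕ} (s : L.Op (n + 1)), rho (lam s) = s
  rho_map : ∀ {m n : ℕ} (f : Fin m → Fin n) (t : L.Op m),
    rho (L.map f t) = L.map (liftRen f) (rho t)
  lam_map : ∀ {m n : ℕ} (f : Fin m → Fin n) (t : L.Op (m + 1)),
    lam (L.map (liftRen f) t) = L.map f (lam t)
  rho_comp : ∀ {m n : ℕ} (t : L.Op m) (s : Fin m → L.Op n),
    rho (L.comp t s) = L.comp (rho t) (L.lift s)
  lam_comp : ∀ {m n : ℕ} (t : L.Op (m + 1)) (s : Fin m → L.Op n),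
    lam (L.comp t (L.lift s)) = L.comp (lam t) s

/-- A map of algebraic theories commutes with retraction and section. -/
structure PreservesSemiClosed {L M : AlgTheory.{u}} (σ : SemiClosed L) (τ : SemiClosed M)
    (F : L ⟶ M) : Prop where
  app_rho : ∀ {n : ℕ} (t : L.Op n), F.app (σ.rho t) = τ.rho (F.app t)
  app_lam : ∀ {n : ℕ} (t : L.Op (n + 1)), F.app (σ.lam t) = τ.lam (F.app t)

end AlgTheory

open AlgTheory

/-- A `λ`-theory: an algebraic theory equipped with semi-closed structure. -/
structure LambdaTheory : Type (u + 1) where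
  theory : AlgTheory.{u}
  semiClosed : SemiClosed theory

namespace LambdaTheory

/-- Maps of `λ`-theories. -/
@[ext]
structure Hom (L M : LambdaTheory.{u}) : Type u where
  hom : L.theory ⟶ M.theory
  preserves : PreservesSemiClosed L.semiClosed M.semiClosed hom

instance : Category LambdaTheory.{u} where
  Hom := Hom
  id L := ⟨𝟙 L.theory, ⟨fun _ => rfl, fun _ => rfl⟩⟩
  comp F G := ⟨F.hom ≫ G.hom,
    ⟨fun t => (congrArg G.hom.app (F.preserves.app_rho t)).trans (G.preserves.app_rho _),
      fun t => (congrArg G.hom.app (F.preserves.app_lam t)).trans (G.preserves.app_lam _)⟩⟩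

end LambdaTheory

/-! ## The pure `λ`-calculus -/

/-- Well-scoped `λ`-terms in context of length `n`; abstraction binds the last variable. -/
inductive Tm : ℕ → Type u
  | var {n : ℕ} (i : Fin n) : Tm n
  | app {n : ℕ} (s t : Tm n) : Tm n
  | lam {n : ℕ} (s : Tm (n + 1)) : Tm n

namespace Tm

/-- Renaming of variables. -/
def rename : ∀ {n m : ℕ}, (Fin n → Fin m) → Tm.{u} n → Tm.{u} m
  | _, _, f, var i => var (f i)
  | _, _, f, app s t => app (rename f s) (rename f t)
  | _, _, f, lam s => lam (rename (liftRen f) s)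

/-- Extend a substitution under a binder. -/
def liftSub {n m : ℕ} (σ : Fin n → Tm.{u} m) : Fin (n + 1) → Tm.{u} (m + 1) :=
  Fin.snoc (α := fun _ => Tm.{u} (m + 1)) (fun i => rename Fin.castSucc (σ i)) (var (Fin.last m))

/-- Capture-avoiding simultaneous substitution. -/
def subst : ∀ {n m : ℕ}, (Fin n → Tm.{u} m) → Tm.{u} n → Tm.{u} m
  | _, _, σ, var i => σ i
  | _, _, σ, app s t => app (subst σ s) (subst σ t)
  | _, _, σ, lam s => lam (subst (liftSub σ) s)

/-- `s[t/z]` for the last variable `z`. -/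
def inst {n : ℕ} (s : Tm.{u} (n + 1)) (t : Tm.{u} n) : Tm.{u} n :=
  subst (Fin.snoc (α := fun _ => Tm.{u} n) var t) s

/-- `β`-equality. -/
inductive BetaEq : ∀ {n : ℕ}, Tm.{u} n → Tm.{u} n → Prop
  | beta {n : ℕ} (s : Tm n.succ) (t : Tm n) : BetaEq (app (lam s) t) (inst s t)
  | refl {n : ℕ} (s : Tm n) : BetaEq s s
  | symm {n : ℕ} {s t : Tm n} : BetaEq s t → BetaEq t s
  | trans {n : ℕ} {r s t : Tm n} : BetaEq r s → BetaEq s t → BetaEq r t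
  | app {n : ℕ} {s s' t t' : Tm n} : BetaEq s s' → BetaEq t t' → BetaEq (app s t) (app s' t')
  | lam {n : ℕ} {s s' : Tm n.succ} : BetaEq s s' → BetaEq (lam s) (lam s')

theorem liftRen_id {n : ℕ} : liftRen (id : Fin n → Fin n) = id := by
  funext i
  refine Fin.lastCases ?_ (fun i => ?_) i <;> simp [liftRen]

theorem liftRen_comp {l m n : ℕ} (f : Fin l → Fin m) (g : Fin m → Fin n) :
    liftRen g ∘ liftRen f = liftRen (g ∘ f) := by
  funext i
  refine Fin.lastCases ?_ (fun i => ?_) i <;> simp [liftRen]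

theorem rename_id {n : ℕ} (t : Tm.{u} n) : rename id t = t := by
  induction t with
  | var i => rfl
  | app s t ihs iht => simp only [rename, ihs, iht]
  | lam s ih => simp only [rename, liftRen_id, ih]

theorem rename_rename {l m n : ℕ} (f : Fin l → Fin m) (g : Fin m → Fin n) (t : Tm.{u} l) :
    rename g (rename f t) = rename (g ∘ f) t := by
  induction t generalizing m n with
  | var i => rfl
  | app s t ihs iht => simp only [rename, ihs, iht]
  | lam s ih => simp only [rename, ih, liftRen_comp]

theorem liftSub_liftRen {l m n : ℕ} (f : Fin l → Fin m) (σ : Fin m → Tm.{u} n) :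
    liftSub σ ∘ liftRen f = liftSub (σ ∘ f) := by
  funext i
  refine Fin.lastCases ?_ (fun i => ?_) i <;> simp [liftRen, liftSub]

theorem subst_rename {l m n : ℕ} (f : Fin l → Fin m) (σ : Fin m → Tm.{u} n) (t : Tm.{u} l) :
    subst σ (rename f t) = subst (σ ∘ f) t := by
  induction t generalizing m n with
  | var i => rfl
  | app s t ihs iht => simp only [rename, subst, ihs, iht]
  | lam s ih => simp only [rename, subst, ih, liftSub_liftRen]

theorem liftSub_rename {l m n : ℕ} (σ : Fin l → Tm.{u} m) (g : Fin m → Fin n) :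
    (fun i => rename (liftRen g) (liftSub σ i)) = liftSub (fun i => rename g (σ i)) := by
  funext i
  refine Fin.lastCases ?_ (fun i => ?_) i
  · simp [liftRen, liftSub, rename]
  · simp only [liftSub, Fin.snoc_castSucc, rename_rename]
    congr 1
    funext j
    simp [liftRen]

theorem rename_subst {l m n : ℕ} (σ : Fin l → Tm.{u} m) (g : Fin m → Fin n) (t : Tm.{u} l) :
    rename g (subst σ t) = subst (fun i => rename g (σ i)) t := by
  induction t generalizing m n with
  | var i => rfl
  | app s t ihs iht => simp only [rename, subst, ihs, iht]
  | lam s ih => simp only [rename, subst, ih, liftSub_rename]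

theorem liftSub_subst {l m n : ℕ} (σ : Fin l → Tm.{u} m) (τ : Fin m → Tm.{u} n) :
    (fun i => subst (liftSub τ) (liftSub σ i)) = liftSub (fun i => subst τ (σ i)) := by
  funext i
  refine Fin.lastCases ?_ (fun i => ?_) i
  · simp [liftSub, subst]
  · simp only [liftSub, Fin.snoc_castSucc, rename_subst, subst_rename]
    congr 1
    funext j
    simp

theorem subst_subst {l m n : ℕ} (σ : Fin l → Tm.{u} m) (τ : Fin m → Tm.{u} n) (t : Tm.{u} l) :
    subst τ (subst σ t) = subst (fun i => subst τ (σ i)) t := by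
  induction t generalizing m n with
  | var i => rfl
  | app s t ihs iht => simp only [subst, ihs, iht]
  | lam s ih => simp only [subst, ih, liftSub_subst]

theorem liftSub_var {n m : ℕ} (f : Fin n → Fin m) :
    liftSub (fun i => (var (f i) : Tm.{u} m)) = fun i => var (liftRen f i) := by
  funext i
  refine Fin.lastCases ?_ (fun i => ?_) i <;> simp [liftRen, liftSub, rename]

theorem rename_eq_subst {n m : ℕ} (f : Fin n → Fin m) (t : Tm.{u} n) :
    rename f t = subst (fun i => var (f i)) t := by
  induction t generalizing m with
  | var i => rfl
  | app s t ihs iht => simp only [rename, subst, ihs, iht]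
  | lam s ih => simp only [rename, subst, ih, liftSub_var]

theorem subst_var {n : ℕ} (t : Tm.{u} n) : subst var t = t := by
  have h := rename_eq_subst id t
  rw [rename_id] at h
  exact h.symm

theorem subst_inst {n m : ℕ} (σ : Fin n → Tm.{u} m) (s : Tm.{u} (n + 1)) (t : Tm.{u} n) :
    subst σ (inst s t) = inst (subst (liftSub σ) s) (subst σ t) := by
  simp only [inst, subst_subst]
  congr 1
  funext i
  refine Fin.lastCases ?_ (fun i => ?_) i
  · simp [liftSub, subst]
  · simp only [liftSub, Fin.snoc_castSucc, subst_rename, subst]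
    conv_lhs => rw [← subst_var (σ i)]
    congr 1
    funext j
    simp

theorem betaEq_subst {n m : ℕ} (σ : Fin n → Tm.{u} m) {s t : Tm.{u} n} (h : BetaEq s t) :
    BetaEq (subst σ s) (subst σ t) := by
  induction h generalizing m with
  | beta s t =>
    rw [subst_inst]
    exact .beta _ _
  | refl s => exact .refl _
  | symm _ ih => exact (ih σ).symm
  | trans _ _ ih₁ ih₂ => exact (ih₁ σ).trans (ih₂ σ)
  | app _ _ ih₁ ih₂ => exact .app (ih₁ σ) (ih₂ σ)
  | lam _ ih => exact .lam (ih _)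

theorem betaEq_rename {n m : ℕ} (f : Fin n → Fin m) {s t : Tm.{u} n} (h : BetaEq s t) :
    BetaEq (rename f s) (rename f t) := by
  rw [rename_eq_subst, rename_eq_subst]
  exact betaEq_subst _ h

theorem subst_betaEq {n m : ℕ} {σ τ : Fin n → Tm.{u} m} (h : ∀ i, BetaEq (σ i) (τ i))
    (t : Tm.{u} n) : BetaEq (subst σ t) (subst τ t) := by
  induction t generalizing m with
  | var i => exact h i
  | app s t ihs iht => exact .app (ihs h) (iht h)
  | lam s ih =>
    refine .lam (ih fun i => ?_)
    refine Fin.lastCases ?_ (fun i => ?_) i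
    · simp only [liftSub, Fin.snoc_last]
      exact .refl _
    · simp only [liftSub, Fin.snoc_castSucc]
      exact betaEq_rename _ (h i)

end Tm

/-- `β`-equality as a setoid. -/
def betaSetoid (n : ℕ) : Setoid (Tm.{u} n) := ⟨Tm.BetaEq, .refl, .symm, .trans⟩

/-- `λ`-terms in context of length `n` up to `β`-equality. -/
def LamOp (n : ℕ) : Type u := Quotient (betaSetoid.{u} n)

namespace LamOp

/-- The class of a term. -/
def mk {n : ℕ} (t : Tm.{u} n) : LamOp.{u} n := Quotient.mk (betaSetoid n) t

theorem sound {n : ℕ} {s t : Tm.{u} n} (h : Tm.BetaEq s t) : mk s = mk t := Quotient.sound h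

theorem exists_rep {n : ℕ} (x : LamOp.{u} n) : ∃ y, mk y = x := Quotient.exists_rep x

theorem exists_reps {k n : ℕ} (x : Fin k → LamOp.{u} n) : ∃ y : Fin k → Tm.{u} n,
    x = fun i => mk (y i) := by
  choose y hy using fun i => exists_rep (x i)
  exact ⟨y, funext fun i => (hy i).symm⟩

/-- Renaming on classes. -/
def map {n m : ℕ} (f : Fin n → Fin m) (x : LamOp.{u} n) : LamOp.{u} m :=
  Quotient.lift (fun t => mk (Tm.rename f t)) (fun _ _ h => sound (Tm.betaEq_rename f h)) x

/-- Substitution on classes. -/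
noncomputable def comp {n m : ℕ} (x : LamOp.{u} n) (σ : Fin n → LamOp.{u} m) : LamOp.{u} m :=
  Quotient.lift (fun t => mk (Tm.subst (fun i => Quotient.out (σ i)) t))
    (fun _ _ h => sound (Tm.betaEq_subst _ h)) x

theorem comp_mk {n m : ℕ} (t : Tm.{u} n) (σ : Fin n → Tm.{u} m) :
    comp (mk t) (fun i => mk (σ i)) = mk (Tm.subst σ t) :=
  sound (Tm.subst_betaEq (fun i => Quotient.exact (Quotient.out_eq (mk (σ i)))) t)

/-- `t ↦ t z` on classes. -/
def rho {n : ℕ} (x : LamOp.{u} n) : LamOp.{u} (n + 1) :=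
  Quotient.lift (fun t => mk (.app (Tm.rename Fin.castSucc t) (.var (Fin.last n))))
    (fun _ _ h => sound (.app (Tm.betaEq_rename _ h) (.refl _))) x

/-- `s ↦ λ z. s` on classes. -/
def lam {n : ℕ} (x : LamOp.{u} (n + 1)) : LamOp.{u} n :=
  Quotient.lift (fun t => mk (.lam t)) (fun _ _ h => sound (.lam h)) x

end LamOp

/-- The algebraic theory of `λ`-terms up to `β`-equality. -/
noncomputable def lamTheory : AlgTheory.{u} where
  Op := LamOp
  map := LamOp.map
  pr i := LamOp.mk (.var i)
  comp := LamOp.comp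
  map_id t := by
    obtain ⟨t, rfl⟩ := LamOp.exists_rep t
    exact congrArg LamOp.mk (Tm.rename_id t)
  map_map f g t := by
    obtain ⟨t, rfl⟩ := LamOp.exists_rep t
    exact congrArg LamOp.mk (Tm.rename_rename f g t)
  map_pr f i := rfl
  pr_comp i s := by
    obtain ⟨s, rfl⟩ := LamOp.exists_reps s
    exact LamOp.comp_mk _ _
  comp_pr t := by
    obtain ⟨t, rfl⟩ := LamOp.exists_rep t
    rw [LamOp.comp_mk, Tm.subst_var]
  comp_assoc t s r := by
    obtain ⟨t, rfl⟩ := LamOp.exists_rep t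
    obtain ⟨s, rfl⟩ := LamOp.exists_reps s
    obtain ⟨r, rfl⟩ := LamOp.exists_reps r
    simp only [LamOp.comp_mk, Tm.subst_subst]
  map_comp_left f t s := by
    obtain ⟨t, rfl⟩ := LamOp.exists_rep t
    obtain ⟨s, rfl⟩ := LamOp.exists_reps s
    refine (LamOp.comp_mk (Tm.rename f t) s).trans ?_
    rw [Tm.subst_rename]
    exact (LamOp.comp_mk t (s ∘ f)).symm
  map_comp_right g t s := by
    obtain ⟨t, rfl⟩ := LamOp.exists_rep t
    obtain ⟨s, rfl⟩ := LamOp.exists_reps s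
    rw [LamOp.comp_mk]
    refine (LamOp.comp_mk t _).trans ?_
    exact congrArg LamOp.mk (Tm.rename_subst s g t).symm

theorem lamTheory_lift {m n : ℕ} (s : Fin m → Tm.{u} n) :
    lamTheory.{u}.lift (fun i => LamOp.mk (s i)) = fun i => LamOp.mk (Tm.liftSub s i) := by
  funext i
  refine Fin.lastCases ?_ (fun i => ?_) i
  · simp only [AlgTheory.lift, Tm.liftSub, Fin.snoc_last]
    rfl
  · simp only [AlgTheory.lift, Tm.liftSub, Fin.snoc_castSucc]
    rfl

/-- The `λ`-theory `Λ` of the pure `λ`-calculus. -/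
noncomputable def Lam : LambdaTheory.{u} where
  theory := lamTheory
  semiClosed :=
    { rho := LamOp.rho
      lam := LamOp.lam
      rho_lam := fun s => by
        obtain ⟨s, rfl⟩ := LamOp.exists_rep s
        refine (LamOp.sound (Tm.BetaEq.beta _ _)).trans (congrArg LamOp.mk ?_)
        rw [Tm.inst, Tm.subst_rename]
        conv_rhs => rw [← Tm.subst_var s]
        congr 1
        funext i
        refine Fin.lastCases ?_ (fun i => ?_) i <;> simp [liftRen]
      rho_map := fun f t => by
        obtain ⟨t, rfl⟩ := LamOp.exists_rep t
        refine congrArg LamOp.mk ?_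
        simp only [Tm.rename, Tm.rename_rename]
        congr 2
        · funext i
          simp [liftRen]
        · simp [liftRen]
      lam_map := fun f t => by
        obtain ⟨t, rfl⟩ := LamOp.exists_rep t
        rfl
      rho_comp := fun t s => by
        obtain ⟨t, rfl⟩ := LamOp.exists_rep t
        obtain ⟨s, rfl⟩ := LamOp.exists_reps s
        rw [lamTheory_lift]
        refine (congrArg LamOp.rho (LamOp.comp_mk t s)).trans ?_
        refine Eq.trans (congrArg LamOp.mk ?_) (LamOp.comp_mk _ _).symm
        simp only [Tm.subst, Tm.rename_subst, Tm.subst_rename]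
        congr 2
        · funext i
          simp [Tm.liftSub]
        · simp [Tm.liftSub]
      lam_comp := fun t s => by
        obtain ⟨t, rfl⟩ := LamOp.exists_rep t
        obtain ⟨s, rfl⟩ := LamOp.exists_reps s
        rw [lamTheory_lift]
        refine (congrArg LamOp.lam (LamOp.comp_mk t _)).trans ?_
        exact (LamOp.comp_mk (.lam t) s).symm }

/-! ## Interpretation of `λ`-terms; initiality of `Λ` -/

namespace LambdaTheory

variable (L : LambdaTheory.{u})

/-- Application of `s` to `t`, that is `(s z)[t/z]`. -/
def appl {n : ℕ} (s t : L.theory.Op n) : L.theory.Op n :=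
  L.theory.comp (L.semiClosed.rho s) (Fin.snoc (α := fun _ => L.theory.Op n) L.theory.pr t)

/-- The interpretation of a `λ`-term. -/
def interp : ∀ {n : ℕ}, Tm.{u} n → L.theory.Op n
  | _, .var i => L.theory.pr i
  | _, .app s t => L.appl (interp s) (interp t)
  | _, .lam s => L.semiClosed.lam (interp s)

theorem appl_comp {n m : ℕ} (s t : L.theory.Op n) (σ : Fin n → L.theory.Op m) :
    L.theory.comp (L.appl s t) σ = L.appl (L.theory.comp s σ) (L.theory.comp t σ) := by
  simp only [appl, L.theory.comp_assoc, L.semiClosed.rho_comp]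
  congr 1
  funext i
  refine Fin.lastCases ?_ (fun i => ?_) i
  · simp [AlgTheory.lift, L.theory.pr_comp]
  · simp only [AlgTheory.lift, Fin.snoc_castSucc, L.theory.pr_comp, L.theory.map_comp_left]
    conv_lhs => rw [← L.theory.comp_pr (σ i)]
    congr 1
    funext j
    simp

theorem interp_rename {n m : ℕ} (f : Fin n → Fin m) (t : Tm.{u} n) :
    L.interp (Tm.rename f t) = L.theory.map f (L.interp t) := by
  induction t generalizing m with
  | var i => simp only [Tm.rename, interp, L.theory.map_pr]
  | app s t ihs iht =>
    rw [L.theory.map_eq_comp]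
    simp only [Tm.rename, interp, ihs, iht, appl_comp, L.theory.map_eq_comp]
  | lam s ih => simp only [Tm.rename, interp, ih, L.semiClosed.lam_map]

theorem interp_liftSub {n m : ℕ} (σ : Fin n → Tm.{u} m) :
    (fun i => L.interp (Tm.liftSub σ i)) = L.theory.lift (fun i => L.interp (σ i)) := by
  funext i
  refine Fin.lastCases ?_ (fun i => ?_) i
  · simp [AlgTheory.lift, Tm.liftSub, interp]
  · simp [AlgTheory.lift, Tm.liftSub, interp_rename]

theorem interp_subst {n m : ℕ} (σ : Fin n → Tm.{u} m) (t : Tm.{u} n) :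
    L.interp (Tm.subst σ t) = L.theory.comp (L.interp t) (fun i => L.interp (σ i)) := by
  induction t generalizing m with
  | var i => simp only [Tm.subst, interp, L.theory.pr_comp]
  | app s t ihs iht => simp only [Tm.subst, interp, ihs, iht, appl_comp]
  | lam s ih => simp only [Tm.subst, interp, ih, interp_liftSub, L.semiClosed.lam_comp]

theorem interp_betaEq {n : ℕ} {s t : Tm.{u} n} (h : Tm.BetaEq s t) : L.interp s = L.interp t := by
  induction h with
  | beta s t =>
    simp only [interp, appl, L.semiClosed.rho_lam, Tm.inst, interp_subst]
    congr 1
    funext i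
    refine Fin.lastCases ?_ (fun i => ?_) i <;> simp [interp]
  | refl s => rfl
  | symm _ ih => exact ih.symm
  | trans _ _ ih₁ ih₂ => exact ih₁.trans ih₂
  | app _ _ ih₁ ih₂ => simp only [interp, ih₁, ih₂]
  | lam _ ih => simp only [interp, ih]

/-- The map of `λ`-theories `Λ ⟶ L` given by interpretation. -/
noncomputable def fromLam : Lam.{u} ⟶ L where
  hom :=
    { app := fun x => Quotient.lift L.interp (fun _ _ h => L.interp_betaEq h) x
      app_map := fun f t => by
        obtain ⟨t, rfl⟩ := LamOp.exists_rep t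
        exact L.interp_rename f t
      app_pr := fun i => rfl
      app_comp := fun t s => by
        obtain ⟨t, rfl⟩ := LamOp.exists_rep t
        obtain ⟨s, rfl⟩ := LamOp.exists_reps s
        refine Eq.trans ?_ (L.interp_subst s t)
        exact congrArg (Quotient.lift L.interp (fun _ _ h => L.interp_betaEq h))
          (LamOp.comp_mk t s) }
  preserves :=
    { app_rho := fun t => by
        obtain ⟨t, rfl⟩ := LamOp.exists_rep t
        change L.appl (L.interp (Tm.rename Fin.castSucc t)) (L.theory.pr (Fin.last _)) =
          L.semiClosed.rho (L.interp t)
        rw [appl, interp_rename, L.semiClosed.rho_map, L.theory.map_comp_left]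
        conv_rhs => rw [← L.theory.comp_pr (L.semiClosed.rho (L.interp t))]
        congr 1
        funext i
        refine Fin.lastCases ?_ (fun i => ?_) i <;> simp [liftRen]
      app_lam := fun t => by
        obtain ⟨t, rfl⟩ := LamOp.exists_rep t
        rfl }

theorem hom_appl {L M : LambdaTheory.{u}} (F : L ⟶ M) {n : ℕ} (s t : L.theory.Op n) :
    F.hom.app (L.appl s t) = M.appl (F.hom.app s) (F.hom.app t) := by
  simp only [appl, F.hom.app_comp, F.preserves.app_rho]
  congr 1
  funext i
  refine Fin.lastCases ?_ (fun i => ?_) i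
  · simp
  · simp [F.hom.app_pr]

theorem lam_appl {n : ℕ} (s t : Tm.{u} n) :
    Lam.appl (LamOp.mk s) (LamOp.mk t) = LamOp.mk (.app s t) := by
  have h : (Fin.snoc (α := fun _ => LamOp.{u} n) (fun i => LamOp.mk (.var i)) (LamOp.mk t)) =
      fun i => LamOp.mk (Fin.snoc (α := fun _ => Tm.{u} n) Tm.var t i) := by
    funext i
    refine Fin.lastCases ?_ (fun i => ?_) i <;> simp
  refine (congrArg (LamOp.comp (LamOp.rho (LamOp.mk s))) h).trans ?_
  refine (LamOp.comp_mk _ _).trans (congrArg LamOp.mk ?_)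
  simp only [Tm.subst, Tm.subst_rename, Fin.snoc_last]
  congr 1
  conv_rhs => rw [← Tm.subst_var s]
  congr 1
  funext i
  simp

theorem eq_fromLam (F : Lam.{u} ⟶ L) : F = L.fromLam := by
  apply Hom.ext
  apply AlgTheory.hom_ext
  intro n t
  obtain ⟨t, rfl⟩ := LamOp.exists_rep t
  change F.hom.app (LamOp.mk t) = L.interp t
  induction t with
  | var i => exact F.hom.app_pr i
  | app s t ihs iht =>
    refine (congrArg F.hom.app (lam_appl s t).symm).trans ((hom_appl F _ _).trans ?_)
    rw [ihs, iht]
    rfl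
  | lam s ih =>
    refine (F.preserves.app_lam (LamOp.mk s)).trans ?_
    rw [ih]
    rfl

/-- `Λ` is the initial `λ`-theory. -/
noncomputable def lamIsInitial : Limits.IsInitial Lam.{u} :=
  Limits.IsInitial.ofUniqueHom fromLam eq_fromLam

end LambdaTheory

/-! ## The two functors -/

/-- The category of `Λ`-algebras: algebras for the initial `λ`-theory. -/
abbrev LamAlg : Type (u + 1) := Alg Lam.{u}.theory

/-- The functor `L ↦ L(0)` from `λ`-theories to `Λ`-algebras: the initial `L`-algebra, restricted
along `Λ ⟶ L`. -/
noncomputable def atZero : LambdaTheory.{u} ⥤ LamAlg.{u} where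
  obj L := Alg.restrict L.fromLam.hom (L.theory.freeAlg 0)
  map {L M} F :=
    { toFun := fun a => F.hom.app a
      map_act := fun t a => by
        refine (F.hom.app_comp _ _).trans ?_
        have h : L.fromLam ≫ F = M.fromLam := M.eq_fromLam _
        rw [← h]
        rfl }

/-- The functor `A ↦ Λ_A` from `Λ`-algebras to `λ`-theories determined by semi-closed structures
on the theories of extensions `Λ_A` which are preserved by the induced maps `Λ_A ⟶ Λ_B`. -/
noncomputable def extFunctor (σ : ∀ A : LamAlg.{u}, SemiClosed (Lam.theory.ext A))
    (hσ : ∀ {A B : LamAlg.{u}} (f : A ⟶ B),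
      PreservesSemiClosed (σ A) (σ B) (Lam.theory.extMap f)) :
    LamAlg.{u} ⥤ LambdaTheory.{u} where
  obj A := ⟨Lam.theory.ext A, σ A⟩
  map f := ⟨Lam.theory.extMap f, hσ f⟩
  map_id A := LambdaTheory.Hom.ext (extMap_id _ A)
  map_comp f g := LambdaTheory.Hom.ext (extMap_comp _ f g)

end LambdaCalc

open LambdaCalc LambdaCalc.AlgTheory

namespace LambdaCalc

/-! ### Substitution under a binder, and homomorphisms out of free extensions -/

namespace AlgTheory

/-! The point is to abstract over a new indeterminate using only the algebra structure. In a
`Λ`-algebra `B`, the elements `b = λz. b z` form another `Λ`-algebra `fn B`, where an operation `t`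
acts by `λz. t(b₁ z, …, bₖ z)`. It receives a homomorphism `b ↦ λz. b` from `B` and contains `λz.
z`. As `Λ_A(n+1)` is free on `A` and `n+1` indeterminates, there is a unique homomorphism `absHom :
Λ_A(n+1) ⟶ fn (Λ_A(n))` sending constants and old variables to constant functions and the last
variable to `λz. z`. This is `λ` on `Λ_A`. The retraction `ρ` needs no construction: it is
substitution into the image of the single operation `x z` of `Λ`.

Every law for `λ` then becomes an equality of homomorphisms out of a free extension, checked on
constants and variables (`extAlg_hom_ext`, `eq_absHom_fnMap`). This yields `ρ ∘ λ = id`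
(`rhoOf_absHom`), compatibility with substitution (`absHom_comp`), functoriality in `A`
(`extSemiClosed_extMap`), and the fact that the comparison `Λ_{L(0)} ⟶ L` preserves `λ`
(`comparison_preserves`).

The comparison is bijective by induction on arity. In arity `0` it is evaluation `Λ_A(0) ≅ A`. In
arity `n+1`, `λ` embeds operations into arity `n` with left inverse `ρ`, and the comparison commutes
with both (`comparison_bijective`). The adjunction has the inverse of the comparison as unit and
evaluation as counit; the triangle identities say that each of these isomorphisms is carried to the
other by the functors (`extMap_evalHom`, `evalHom_atZero`). -/

theorem lift_castSucc (T : AlgTheory.{u}) {m n : ℕ} (s : Fin m → T.Op n) (i : Fin m) :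
    T.lift s i.castSucc = T.map Fin.castSucc (s i) := by
  rw [lift, Fin.snoc_castSucc]

theorem lift_last (T : AlgTheory.{u}) {m n : ℕ} (s : Fin m → T.Op n) :
    T.lift s (Fin.last m) = T.pr (Fin.last n) := by
  rw [lift, Fin.snoc_last]

theorem lift_comp (T : AlgTheory.{u}) {l m n : ℕ} (t : Fin l → T.Op m) (s : Fin m → T.Op n) :
    (fun i => T.comp (T.lift t i) (T.lift s)) = T.lift (fun i => T.comp (t i) s) := by
  funext i
  refine Fin.lastCases ?_ (fun i => ?_) i
  · simp [lift, T.pr_comp]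
  · simp only [lift, Fin.snoc_castSucc, T.map_comp_left, ← T.map_comp_right]
    congr 1
    funext j
    simp

theorem lift_pr (T : AlgTheory.{u}) {m n : ℕ} (f : Fin m → Fin n) :
    T.lift (fun i => T.pr (f i)) = fun i => T.pr (liftRen f i) := by
  funext i
  refine Fin.lastCases ?_ (fun i => ?_) i <;> simp [lift, liftRen, T.map_pr]

theorem Hom.app_lift {S T : AlgTheory.{u}} (F : S ⟶ T) {m n : ℕ} (s : Fin m → S.Op n) :
    (fun i => F.app (S.lift s i)) = T.lift (fun i => F.app (s i)) := by
  funext i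
  refine Fin.lastCases ?_ (fun i => ?_) i
  · simp [lift, F.app_pr]
  · simp [lift, F.app_map]

theorem comp_castSucc_lift (T : AlgTheory.{u}) {m n : ℕ} (t : T.Op m) (s : Fin m → T.Op n) :
    T.comp (T.map Fin.castSucc t) (T.lift s) = T.map Fin.castSucc (T.comp t s) := by
  rw [T.map_comp_left, ← T.map_comp_right]
  congr 1
  funext j
  simp [lift]

/-- Substitution as a homomorphism between free algebras, over any base theory. -/
def substHom {S T : AlgTheory.{u}} (F : S ⟶ T) {m n : ℕ} (s : Fin m → T.Op n) :
    Alg.restrict F (T.freeAlg m) ⟶ Alg.restrict F (T.freeAlg n) where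
  toFun t := T.comp t s
  map_act t a := T.comp_assoc (F.app t) a s

/-- The free extension of `A` by `n` indeterminates, as an `S`-algebra. -/
noncomputable abbrev extAlg (S : AlgTheory.{u}) (A : Alg S) (n : ℕ) : Alg S :=
  Alg.restrict (S.extIncl A) ((S.ext A).freeAlg n)

/-- The uniqueness half of freeness: a formal operation applied to terms is the `S`-action on their
classes, so agreement propagates from the generators by induction on terms. -/
theorem extAlg_hom_ext {S : AlgTheory.{u}} {A B : Alg S} {n : ℕ} {f g : S.extAlg A n ⟶ B}
    (hc : ∀ a : A.carrier, f.toFun (ExtOp.mk (.const a)) = g.toFun (ExtOp.mk (.const a)))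
    (hv : ∀ i : Fin n, f.toFun (ExtOp.mk (.var i)) = g.toFun (ExtOp.mk (.var i))) : f = g := by
  apply Alg.Hom.ext
  funext x
  obtain ⟨x, rfl⟩ := ExtOp.exists_rep x
  induction x with
  | var i => exact hv i
  | const a => exact hc a
  | op t x ih =>
    have h : (ExtOp.mk (.op t x) : ExtOp S A n) =
        (S.extAlg A n).act t (fun i => ExtOp.mk (x i)) :=
      (ExtOp.comp_mk (.op t .var) x).symm
    rw [h]
    exact (f.map_act t _).trans ((congrArg (B.act t) (funext ih)).trans (g.map_act t _).symm)

theorem extAlg_hom_congr {S : AlgTheory.{u}} {A B : Alg S} {n : ℕ} {f g : S.extAlg A n ⟶ B}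
    (h : f = g) (x : ExtOp S A n) : f.toFun x = g.toFun x := by rw [h]

theorem extAlg_comp_const {S : AlgTheory.{u}} {A : Alg S} {m n : ℕ} (a : A.carrier)
    (s : Fin m → ExtOp S A n) :
    (S.ext A).comp (ExtOp.mk (.const a)) s = ExtOp.mk (.const a) := by
  obtain ⟨s, rfl⟩ := ExtOp.exists_reps s
  exact ExtOp.comp_mk _ _

/-- The weakening homomorphism, over any base theory. -/
def weakenHom {S T : AlgTheory.{u}} (F : S ⟶ T) (n : ℕ) :
    Alg.restrict F (T.freeAlg n) ⟶ Alg.restrict F (T.freeAlg (n + 1)) where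
  toFun t := T.map Fin.castSucc t
  map_act t a := (T.map_comp_right Fin.castSucc (F.app t) a).symm

end AlgTheory

/-! ### Pointwise operations, eta-expansion and constant functions in a `λ`-theory -/

namespace LambdaTheory

variable (L : LambdaTheory.{u})

/-- `λ z. t (x₁ z, …, xₙ z)`. -/
def pointwise {n : ℕ} (t : L.theory.Op n) : L.theory.Op n :=
  L.semiClosed.lam (L.theory.comp t (fun i => L.semiClosed.rho (L.theory.pr i)))

/-- Substitution passes under the binder as `lift s`, and naturality of `ρ` turns each `ρ (pr i)`
into `ρ (s i)`. -/
theorem pointwise_comp {n m : ℕ} (t : L.theory.Op n) (s : Fin n → L.theory.Op m) :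
    L.theory.comp (L.pointwise t) s =
      L.semiClosed.lam (L.theory.comp t (fun i => L.semiClosed.rho (s i))) := by
  simp only [pointwise, ← L.semiClosed.lam_comp, L.theory.comp_assoc, ← L.semiClosed.rho_comp,
    L.theory.pr_comp]

theorem rho_pointwise {n : ℕ} (t : L.theory.Op n) : L.semiClosed.rho (L.pointwise t) =
    L.theory.comp t (fun i => L.semiClosed.rho (L.theory.pr i)) :=
  L.semiClosed.rho_lam _

/-- The inner abstractions are applied at once to the outer bound variable, so they cancel by `β`.
This gives associativity of the pointwise action. -/
theorem comp_pointwise {n m : ℕ} (t : L.theory.Op n) (s : Fin n → L.theory.Op m) :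
    L.pointwise (L.theory.comp t s) =
      L.theory.comp (L.pointwise t) (fun i => L.pointwise (s i)) := by
  simp only [pointwise_comp, rho_pointwise]
  rw [pointwise, L.theory.comp_assoc]

/-- `λ z. x z`, with the free variable `x`. -/
def eta : L.theory.Op 1 := L.semiClosed.lam (L.semiClosed.rho (L.theory.pr 0))

theorem eta_comp {n : ℕ} (s : Fin 1 → L.theory.Op n) :
    L.theory.comp L.eta s = L.semiClosed.lam (L.semiClosed.rho (s 0)) := by
  rw [eta, ← L.semiClosed.lam_comp, ← L.semiClosed.rho_comp, L.theory.pr_comp]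

/-- Without `η` a general element need not be fixed by eta-expansion, but by `β` every abstraction
is; hence pointwise operations take functional values. -/
theorem eta_comp_lam {n : ℕ} (t : L.theory.Op (n + 1)) :
    L.theory.comp L.eta (fun _ => L.semiClosed.lam t) = L.semiClosed.lam t := by
  rw [eta_comp, L.semiClosed.rho_lam]

/-- A pointwise projection eta-expands its argument, so the unit law for the pointwise action holds
exactly on functional elements; this is why `fn` restricts to them. -/
theorem pointwise_pr {n : ℕ} (i : Fin n) :
    L.pointwise (L.theory.pr i) = L.theory.comp L.eta (fun _ => L.theory.pr i) := by
  rw [eta_comp, pointwise, L.theory.pr_comp]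

/-- `λ z. x`, with the free variable `x`. -/
def weakConst : L.theory.Op 1 := L.semiClosed.lam (L.theory.map Fin.castSucc (L.theory.pr 0))

theorem weakConst_comp {n : ℕ} (s : Fin 1 → L.theory.Op n) :
    L.theory.comp L.weakConst s = L.semiClosed.lam (L.theory.map Fin.castSucc (s 0)) := by
  rw [weakConst, ← L.semiClosed.lam_comp, L.theory.comp_castSucc_lift, L.theory.pr_comp]

/-- `λ z. z`. -/
def idConst : L.theory.Op 0 := L.semiClosed.lam (L.theory.pr (Fin.last 0))

theorem idConst_comp {n : ℕ} (s : Fin 0 → L.theory.Op n) :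
    L.theory.comp L.idConst s = L.semiClosed.lam (L.theory.pr (Fin.last n)) := by
  rw [idConst, ← L.semiClosed.lam_comp, L.theory.pr_comp, AlgTheory.lift_last]

/-- Both sides are `λz. t`, since `(λz. xᵢ) z = xᵢ`. This makes `b ↦ λz. b` a homomorphism. -/
theorem weakConst_comp_self {n : ℕ} (t : L.theory.Op n) :
    L.theory.comp L.weakConst (fun _ => t) =
      L.theory.comp (L.pointwise t)
        (fun i => L.theory.comp L.weakConst (fun _ => L.theory.pr i)) := by
  simp only [weakConst_comp, pointwise_comp, L.semiClosed.rho_lam, L.theory.map_eq_comp _ t,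
    L.theory.map_pr]

section Preserves

variable {L} {M : LambdaTheory.{u}} (F : L ⟶ M)

theorem hom_eta : F.hom.app L.eta = M.eta := by
  rw [eta, eta, F.preserves.app_lam, F.preserves.app_rho, F.hom.app_pr]

theorem hom_pointwise {n : ℕ} (t : L.theory.Op n) :
    F.hom.app (L.pointwise t) = M.pointwise (F.hom.app t) := by
  simp only [pointwise, F.preserves.app_lam, F.hom.app_comp, F.preserves.app_rho, F.hom.app_pr]

theorem hom_weakConst : F.hom.app L.weakConst = M.weakConst := by
  rw [weakConst, weakConst, F.preserves.app_lam, F.hom.app_map, F.hom.app_pr]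

theorem hom_idConst : F.hom.app L.idConst = M.idConst := by
  rw [idConst, idConst, F.preserves.app_lam, F.hom.app_pr]

end Preserves

end LambdaTheory

/-! ## Functional elements of a `Λ`-algebra -/

namespace LamAlg

open LambdaTheory

/-- The elements `a` with `a = λ z. a z`, with the operations acting pointwise. -/
noncomputable def fn (A : LamAlg.{u}) : LamAlg.{u} where
  carrier := {a : A.carrier // A.act Lam.eta (fun _ => a) = a}
  act t b := ⟨A.act (Lam.pointwise t) (fun i => (b i).1), by
    rw [← A.act_comp]
    exact congrArg (fun t => A.act t _) (Lam.eta_comp_lam _)⟩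
  act_pr i b := by
    apply Subtype.ext
    change A.act _ _ = _
    rw [pointwise_pr, A.act_comp]
    simp only [A.act_pr]
    exact (b i).2
  act_comp t s b := by
    apply Subtype.ext
    change A.act _ _ = A.act _ _
    rw [comp_pointwise, A.act_comp]
  act_map f t b := by
    apply Subtype.ext
    change A.act _ _ = A.act _ _
    rw [AlgTheory.map_eq_comp, comp_pointwise, A.act_comp]
    congr 1
    funext i
    rw [pointwise_pr, A.act_comp]
    simp only [A.act_pr]
    exact (b (f i)).2

/-- Functoriality of `fn`. -/
noncomputable def fnMap {A B : LamAlg.{u}} (f : A ⟶ B) : fn A ⟶ fn B where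
  toFun a := ⟨f.toFun a.1, (f.map_act Lam.eta (fun _ => a.1)).symm.trans (congrArg f.toFun a.2)⟩
  map_act t a := Subtype.ext (f.map_act (Lam.pointwise t) (fun i => (a i).1))

/-- Constant functions. -/
noncomputable def toFn (A : LamAlg.{u}) : A ⟶ fn A where
  toFun a := ⟨A.act Lam.weakConst (fun _ => a), by
    rw [← A.act_comp]
    exact congrArg (fun t => A.act t _) (Lam.eta_comp_lam _)⟩
  map_act {n} t a := by
    apply Subtype.ext
    change A.act _ (fun _ => A.act t a) = A.act _ _
    rw [← A.act_comp Lam.weakConst (fun _ => t) a, weakConst_comp_self, A.act_comp]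
    simp only [A.act_comp, A.act_pr]

/-- The identity function. -/
noncomputable def idFn (A : LamAlg.{u}) : (fn A).carrier :=
  ⟨A.act Lam.idConst Fin.elim0, by
    have h := A.act_comp Lam.eta (fun _ => Lam.idConst) Fin.elim0
    rw [← h]
    exact congrArg (fun t => A.act t _) (Lam.eta_comp_lam _)⟩

theorem fnMap_toFn {A B : LamAlg.{u}} (f : A ⟶ B) (a : A.carrier) :
    (fnMap f).toFun ((toFn A).toFun a) = (toFn B).toFun (f.toFun a) :=
  Subtype.ext (f.map_act _ _)

theorem fnMap_idFn {A B : LamAlg.{u}} (f : A ⟶ B) : (fnMap f).toFun (idFn A) = idFn B := by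
  apply Subtype.ext
  refine (f.map_act _ _).trans ?_
  exact congrArg (B.act _) (funext fun i => i.elim0)

end LamAlg

/-! ### The retraction of a theory under `Λ` -/

/-- The retraction induced on a theory under `Λ`: `t ↦ t z`. -/
noncomputable def rhoOf {T : AlgTheory.{u}} (F : Lam.{u}.theory ⟶ T) {n : ℕ} (t : T.Op n) :
    T.Op (n + 1) :=
  T.comp (F.app (Lam.semiClosed.rho (Lam.theory.pr (0 : Fin 1)))) (T.lift (fun _ => t))

section rhoOf

variable {T : AlgTheory.{u}} (F : Lam.{u}.theory ⟶ T)

theorem rhoOf_comp {m n : ℕ} (t : T.Op m) (s : Fin m → T.Op n) :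
    rhoOf F (T.comp t s) = T.comp (rhoOf F t) (T.lift s) := by
  rw [rhoOf, rhoOf, T.comp_assoc, T.lift_comp]

/-- Each `t` is the variable `x` with `t` substituted, so naturality of `ρ` determines it from the
single operation `x z`. -/
theorem app_rho {n : ℕ} (t : Lam.{u}.theory.Op n) :
    F.app (Lam.semiClosed.rho t) = rhoOf F (F.app t) := by
  rw [rhoOf, ← Hom.app_lift, ← F.app_comp, ← Lam.semiClosed.rho_comp, Lam.theory.pr_comp]

/-- The `β`-rule `(λz. t(x₁ z, …, xₖ z)) z = t(x₁ z, …, xₖ z)` in `Λ`, transported along `F`. It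
makes evaluation at the new variable a homomorphism on functional elements. -/
theorem rhoOf_pointwise {k n : ℕ} (t : Lam.{u}.theory.Op k) (s : Fin k → T.Op n) :
    rhoOf F (T.comp (F.app (Lam.pointwise t)) s) =
      T.comp (F.app t) (fun i => rhoOf F (s i)) := by
  rw [rhoOf_comp, ← app_rho, LambdaTheory.rho_pointwise, F.app_comp, T.comp_assoc]
  congr 1
  funext i
  rw [app_rho, F.app_pr, ← rhoOf_comp, T.pr_comp]

/-- Evaluation of functional elements at the new variable. -/
noncomputable def rhoHom (n : ℕ) : LamAlg.fn (Alg.restrict F (T.freeAlg n)) ⟶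
    Alg.restrict F (T.freeAlg (n + 1)) where
  toFun b := rhoOf F b.1
  map_act t b := rhoOf_pointwise F t (fun i => (b i).1)

/-- A map of theories under `Λ` commutes with the induced retractions. -/
theorem map_rhoOf {T' : AlgTheory.{u}} (G : T ⟶ T') {n : ℕ} (t : T.Op n) :
    G.app (rhoOf F t) = rhoOf (F ≫ G) (G.app t) := by
  rw [rhoOf, G.app_comp, Hom.app_lift]
  rfl

end rhoOf

/-- A `λ`-theory has no freedom in its retraction once the map from `Λ` is known. -/
theorem rhoOf_fromLam (L : LambdaTheory.{u}) {n : ℕ} (t : L.theory.Op n) :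
    rhoOf L.fromLam.hom t = L.semiClosed.rho t := by
  rw [rhoOf, L.fromLam.preserves.app_rho, ← L.semiClosed.rho_comp, L.fromLam.hom.app_pr,
    L.theory.pr_comp]

/-! ## The semi-closed structure on `Λ_A` -/

/-- The constants of `S_A`, as a homomorphism of `S`-algebras `A ⟶ S_A(n)`. -/
noncomputable def constHom {S : AlgTheory.{u}} (A : Alg S) (n : ℕ) : A ⟶ S.extAlg A n where
  toFun a := ExtOp.mk (.const a)
  map_act t a := by
    refine (ExtOp.sound (ExtRel.op_const t a).symm).trans ?_
    exact (ExtOp.comp_mk (.op t .var) (fun i => .const (a i))).symm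

open LamAlg

/-- Freeness of `Λ_A(n+1)`, with the generators sent to the values that `λz. a`, `λz. xᵢ` and `λz.
z` must have. -/
theorem exists_absHom (A : LamAlg.{u}) (n : ℕ) :
    ∃ h : Lam.theory.extAlg A (n + 1) ⟶ fn (Lam.theory.extAlg A n),
      (∀ a : A.carrier, h.toFun (ExtOp.mk (.const a)) = (toFn _).toFun (ExtOp.mk (.const a))) ∧
      (∀ i : Fin n, h.toFun (ExtOp.mk (.var i.castSucc)) = (toFn _).toFun (ExtOp.mk (.var i))) ∧
      h.toFun (ExtOp.mk (.var (Fin.last n))) = idFn _ := by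
  obtain ⟨h, ⟨hc, hv⟩, -⟩ := ext_free Lam.theory A (fn (Lam.theory.extAlg A n)) (n + 1)
    (constHom A n ≫ toFn _)
    (Fin.snoc (α := fun _ => (fn (Lam.theory.extAlg A n)).carrier)
      (fun i => (toFn (Lam.theory.extAlg A n)).toFun (ExtOp.mk (.var i))) (idFn _))
  refine ⟨h, hc, fun i => ?_, ?_⟩
  · rw [hv, Fin.snoc_castSucc]
  · rw [hv, Fin.snoc_last]

/-- Abstraction of the last variable, as the homomorphism that sends the elements of `Λ_A(n)` to
constant functions and the last variable to the identity. -/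
noncomputable def absHom (A : LamAlg.{u}) (n : ℕ) :
    Lam.theory.extAlg A (n + 1) ⟶ fn (Lam.theory.extAlg A n) :=
  (exists_absHom A n).choose

section absHom

variable (A : LamAlg.{u}) {n : ℕ}

theorem absHom_const (a : A.carrier) :
    (absHom A n).toFun (ExtOp.mk (.const a)) = (toFn _).toFun (ExtOp.mk (.const a)) :=
  (exists_absHom A n).choose_spec.1 a

theorem absHom_castSucc (i : Fin n) :
    (absHom A n).toFun (ExtOp.mk (.var i.castSucc)) = (toFn _).toFun (ExtOp.mk (.var i)) :=
  (exists_absHom A n).choose_spec.2.1 i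

theorem absHom_last : (absHom A n).toFun (ExtOp.mk (.var (Fin.last n))) = idFn _ :=
  (exists_absHom A n).choose_spec.2.2

/-- A homomorphism out of `Λ_A(n + 1)` to functional elements is abstraction followed by a
homomorphism `f` as soon as it is so on the constants and the variables. -/
theorem eq_absHom_fnMap {B : LamAlg.{u}} (f : Lam.theory.extAlg A n ⟶ B)
    (h : Lam.theory.extAlg A (n + 1) ⟶ fn B)
    (hc : ∀ a : A.carrier,
      h.toFun (ExtOp.mk (.const a)) = (toFn B).toFun (f.toFun (ExtOp.mk (.const a))))
    (hv : ∀ i : Fin n,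
      h.toFun (ExtOp.mk (.var i.castSucc)) = (toFn B).toFun (f.toFun (ExtOp.mk (.var i))))
    (hl : h.toFun (ExtOp.mk (.var (Fin.last n))) = idFn B) : h = absHom A n ≫ fnMap f := by
  apply extAlg_hom_ext
  · intro a
    refine (hc a).trans ((fnMap_toFn f _).symm.trans ?_)
    exact congrArg (fnMap f).toFun (absHom_const A a).symm
  · intro i
    refine Fin.lastCases ?_ (fun i => ?_) i
    · refine hl.trans ((fnMap_idFn f).symm.trans ?_)
      exact congrArg (fnMap f).toFun (absHom_last A).symm
    · refine (hv i).trans ((fnMap_toFn f _).symm.trans ?_)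
      exact congrArg (fnMap f).toFun (absHom_castSucc A i).symm

/-- Weakening followed by abstraction is a homomorphism on `Λ_A(n)` that agrees with `toFn` on
generators, so the rule imposed on old variables extends to all terms free of the new variable. -/
theorem absHom_weaken (t : ExtOp Lam.theory A n) :
    (absHom A n).toFun ((Lam.theory.ext A).map Fin.castSucc t) = (toFn _).toFun t := by
  have h : weakenHom (Lam.theory.extIncl A) n ≫ absHom A n = toFn (Lam.theory.extAlg A n) :=
    extAlg_hom_ext (absHom_const A) (absHom_castSucc A)
  exact extAlg_hom_congr h t

end absHom

theorem rhoOf_weakConst {T : AlgTheory.{u}} (F : Lam.{u}.theory ⟶ T) {n : ℕ} (t : T.Op n) :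
    rhoOf F (T.comp (F.app Lam.weakConst) (fun _ => t)) = T.map Fin.castSucc t := by
  rw [rhoOf_comp, ← app_rho, LambdaTheory.weakConst, Lam.semiClosed.rho_lam, F.app_map,
    F.app_pr, T.comp_castSucc_lift, T.pr_comp]

theorem rhoOf_idConst {T : AlgTheory.{u}} (F : Lam.{u}.theory ⟶ T) {n : ℕ} (s : Fin 0 → T.Op n) :
    rhoOf F (T.comp (F.app Lam.idConst) s) = T.pr (Fin.last n) := by
  rw [rhoOf_comp, ← app_rho, LambdaTheory.idConst, Lam.semiClosed.rho_lam, F.app_pr, T.pr_comp,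
    AlgTheory.lift_last]

/-- Abstraction followed by evaluation at the new variable is an endomorphism of `Λ_A(n+1)` fixing
all generators, hence the identity. -/
theorem rhoOf_absHom (A : LamAlg.{u}) {n : ℕ} (t : ExtOp Lam.theory A (n + 1)) :
    rhoOf (Lam.theory.extIncl A) ((absHom A n).toFun t).1 = t := by
  have h : absHom A n ≫ rhoHom (Lam.theory.extIncl A) n = 𝟙 _ := by
    apply extAlg_hom_ext
    · intro a
      refine (congrArg (rhoHom (Lam.theory.extIncl A) n).toFun (absHom_const A a)).trans ?_
      exact rhoOf_weakConst (Lam.theory.extIncl A) (ExtOp.mk (.const a))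
    · intro i
      refine Fin.lastCases ?_ (fun i => ?_) i
      · refine (congrArg (rhoHom (Lam.theory.extIncl A) n).toFun (absHom_last A)).trans ?_
        exact rhoOf_idConst (Lam.theory.extIncl A) _
      · refine (congrArg (rhoHom (Lam.theory.extIncl A) n).toFun (absHom_castSucc A i)).trans ?_
        exact rhoOf_weakConst (Lam.theory.extIncl A) (ExtOp.mk (.var i))
  exact extAlg_hom_congr h t

/-- Both sides are homomorphisms in `t`. On an old variable, `lift s` gives a weakened term rather
than a generator, which is where `absHom_weaken` enters. -/
theorem absHom_comp (A : LamAlg.{u}) {m n : ℕ} (t : ExtOp Lam.theory A (m + 1))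
    (s : Fin m → ExtOp Lam.theory A n) :
    (absHom A n).toFun ((Lam.theory.ext A).comp t ((Lam.theory.ext A).lift s)) =
      (fnMap (substHom (Lam.theory.extIncl A) s)).toFun ((absHom A m).toFun t) := by
  have h : substHom (Lam.theory.extIncl A) ((Lam.theory.ext A).lift s) ≫ absHom A n =
      absHom A m ≫ fnMap (substHom (Lam.theory.extIncl A) s) := by
    apply eq_absHom_fnMap
    · intro a
      refine (congrArg (absHom A n).toFun (extAlg_comp_const a _)).trans ?_
      refine (absHom_const A a).trans (congrArg (toFn _).toFun ?_)
      exact (extAlg_comp_const a _).symm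
    · intro i
      refine (congrArg (absHom A n).toFun (((Lam.theory.ext A).pr_comp i.castSucc _).trans
        ((Lam.theory.ext A).lift_castSucc s i))).trans ?_
      refine (absHom_weaken A (s i)).trans (congrArg (toFn _).toFun ?_)
      exact ((Lam.theory.ext A).pr_comp i s).symm
    · exact (congrArg (absHom A n).toFun (((Lam.theory.ext A).pr_comp (Fin.last m) _).trans
        ((Lam.theory.ext A).lift_last s))).trans (absHom_last A)
  exact extAlg_hom_congr h t

/-- The semi-closed structure on the theory of extensions of a `Λ`-algebra. -/
noncomputable def extSemiClosed (A : LamAlg.{u}) : SemiClosed (Lam.theory.ext A) where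
  rho := rhoOf (Lam.theory.extIncl A)
  lam t := ((absHom A _).toFun t).1
  rho_lam := rhoOf_absHom A
  rho_map f t := by
    rw [map_eq_comp, map_eq_comp, rhoOf_comp, lift_pr]
  -- Renaming is substitution of variables for variables, so this is a case of `absHom_comp`.
  lam_map f t := by
    refine Eq.trans ?_ ((congrArg Subtype.val (absHom_comp A t _)).trans
      ((Lam.theory.ext A).map_eq_comp f _).symm)
    rw [lift_pr, ← map_eq_comp]
  rho_comp := rhoOf_comp _
  lam_comp t s := congrArg Subtype.val (absHom_comp A t s)

theorem extIncl_extMap {S : AlgTheory.{u}} {A B : Alg S} (f : A ⟶ B) :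
    S.extIncl A ≫ S.extMap f = S.extIncl B := rfl

/-- A map of theories under `S`, as a family of homomorphisms between free algebras. -/
def underHom {S T T' : AlgTheory.{u}} {F : S ⟶ T} {F' : S ⟶ T'} (G : T ⟶ T') (h : F ≫ G = F')
    (n : ℕ) : Alg.restrict F (T.freeAlg n) ⟶ Alg.restrict F' (T'.freeAlg n) where
  toFun := G.app
  map_act t a := by
    subst h
    exact G.app_comp (F.app t) a

theorem extSemiClosed_extMap {A B : LamAlg.{u}} (f : A ⟶ B) :
    PreservesSemiClosed (extSemiClosed A) (extSemiClosed B) (Lam.theory.extMap f) where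
  app_rho t := map_rhoOf (Lam.theory.extIncl A) (Lam.theory.extMap f) t
  app_lam {n} t := by
    have h : underHom _ (extIncl_extMap f) (n + 1) ≫ absHom B n =
        absHom A n ≫ fnMap (underHom _ (extIncl_extMap f) n) :=
      eq_absHom_fnMap A _ _ (fun a => absHom_const B (f.toFun a)) (absHom_castSucc B)
        (absHom_last B)
    exact congrArg Subtype.val (extAlg_hom_congr h t).symm

theorem absHom_pr (A : LamAlg.{u}) {n : ℕ} (i : Fin (n + 1)) :
    ((absHom A n).toFun ((Lam.theory.ext A).pr i)).1 =
      (Lam.theory.extIncl A).app (Lam.semiClosed.lam (Lam.theory.pr i)) := by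
  have app_comp {k m : ℕ} (t : Lam.theory.Op k) (s : Fin k → Lam.theory.Op m) :=
    (Lam.theory.extIncl A).app_comp t s
  refine Fin.lastCases ?_ (fun i => ?_) i
  · refine (congrArg Subtype.val (absHom_last A)).trans ?_
    rw [← Lam.idConst_comp Fin.elim0, app_comp]
    exact congrArg ((Lam.theory.ext A).comp ((Lam.theory.extIncl A).app Lam.idConst))
      (funext fun i => i.elim0)
  · refine (congrArg Subtype.val (absHom_castSucc A i)).trans ?_
    have h := Lam.weakConst_comp (fun _ => Lam.theory.pr i)
    rw [Lam.theory.map_pr] at h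
    rw [← h, app_comp, (Lam.theory.extIncl A).app_pr]
    rfl

/-- Writing `t` as `t(x₁, …, xₙ₊₁)`, the homomorphism property of `absHom` turns its abstraction
into the pointwise `t` applied to the elements `λz. xᵢ` and, for the last variable, `λz. z`. By `β`
in `Λ` this is `λz. t`. -/
theorem extSemiClosed_extIncl (A : LamAlg.{u}) :
    PreservesSemiClosed Lam.semiClosed (extSemiClosed A) (Lam.theory.extIncl A) where
  app_rho t := app_rho (Lam.theory.extIncl A) t
  app_lam {n} t := by
    have h : ((absHom A n).toFun ((Lam.theory.ext A).comp ((Lam.theory.extIncl A).app t)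
        (Lam.theory.ext A).pr)).1 = (Lam.theory.ext A).comp
          ((Lam.theory.extIncl A).app (Lam.pointwise t))
          (fun i => ((absHom A n).toFun ((Lam.theory.ext A).pr i)).1) :=
      congrArg Subtype.val ((absHom A n).map_act t (Lam.theory.ext A).pr)
    rw [(Lam.theory.ext A).comp_pr] at h
    refine Eq.trans ?_ h.symm
    rw [funext (absHom_pr A), ← (Lam.theory.extIncl A).app_comp, Lam.pointwise_comp]
    simp only [Lam.semiClosed.rho_lam, Lam.theory.comp_pr]

/-! ## The comparison map -/

/-- By initiality of `Λ`. It identifies the two `Λ`-actions on `Λ_A(0)`: the one in `atZero` and the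
one for which freeness is stated. -/
theorem fromLam_ext (A : LamAlg.{u}) :
    (LambdaTheory.fromLam ⟨Lam.theory.ext A, extSemiClosed A⟩).hom = Lam.theory.extIncl A :=
  congrArg LambdaTheory.Hom.hom
    (LambdaTheory.eq_fromLam ⟨Lam.theory.ext A, extSemiClosed A⟩
      ⟨Lam.theory.extIncl A, extSemiClosed_extIncl A⟩).symm

section Comparison

variable (L : LambdaTheory.{u})

theorem fromLam_pointwise_comp {k n : ℕ} (t : Lam.{u}.theory.Op k) (s : Fin k → L.theory.Op n) :
    L.theory.comp (L.fromLam.hom.app (Lam.pointwise t)) s =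
      L.semiClosed.lam (L.theory.comp (L.fromLam.hom.app t)
        (fun i => L.semiClosed.rho (s i))) := by
  rw [LambdaTheory.hom_pointwise, L.pointwise_comp]

/-- Abstraction in a `λ`-theory as a homomorphism. -/
noncomputable def lamHom (n : ℕ) :
    Alg.restrict L.fromLam.hom (L.theory.freeAlg (n + 1)) ⟶
      fn (Alg.restrict L.fromLam.hom (L.theory.freeAlg n)) where
  toFun t := ⟨L.semiClosed.lam t, by
    change L.theory.comp (L.fromLam.hom.app Lam.eta) (fun _ => L.semiClosed.lam t) = _
    rw [LambdaTheory.hom_eta]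
    exact L.eta_comp_lam t⟩
  map_act t a := by
    apply Subtype.ext
    refine Eq.trans ?_ (fromLam_pointwise_comp L t (fun i => L.semiClosed.lam (a i))).symm
    refine congrArg (fun s => L.semiClosed.lam (L.theory.comp (L.fromLam.hom.app t) s)) ?_
    exact funext fun i => (L.semiClosed.rho_lam (a i)).symm

theorem toFn_fromLam {n : ℕ} (t : L.theory.Op n) :
    ((toFn (Alg.restrict L.fromLam.hom (L.theory.freeAlg n))).toFun t).1 =
      L.semiClosed.lam (L.theory.map Fin.castSucc t) := by
  change L.theory.comp (L.fromLam.hom.app Lam.weakConst) (fun _ => t) = _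
  rw [LambdaTheory.hom_weakConst, L.weakConst_comp]

theorem idFn_fromLam (n : ℕ) :
    (idFn (Alg.restrict L.fromLam.hom (L.theory.freeAlg n))).1 =
      L.semiClosed.lam (L.theory.pr (Fin.last n)) := by
  change L.theory.comp (L.fromLam.hom.app Lam.idConst) Fin.elim0 = _
  rw [LambdaTheory.hom_idConst, L.idConst_comp]

/-- The underlying `Λ`-algebra of the initial `L`-algebra. -/
noncomputable abbrev zeroAlg : LamAlg.{u} := Alg.restrict L.fromLam.hom (L.theory.freeAlg 0)

/-- The retractions on both sides are induced from `Λ`. For abstraction, `λ` in `L` is itself a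
homomorphism into functional elements (`lamHom`), so it suffices to compare on the generators of the
free extension. -/
theorem comparison_preserves :
    PreservesSemiClosed (extSemiClosed (zeroAlg L)) L.semiClosed
      (comparison L.fromLam.hom) where
  app_rho t := by
    refine (map_rhoOf (Lam.theory.extIncl (zeroAlg L)) (comparison L.fromLam.hom) t).trans ?_
    rw [← rhoOf_fromLam]
    exact congrArg (fun F => rhoOf F _) (extIncl_comparison L.fromLam.hom)
  app_lam {n} t := by
    have h : underHom _ (extIncl_comparison L.fromLam.hom) (n + 1) ≫ lamHom L n =
        absHom (zeroAlg L) n ≫ fnMap (underHom _ (extIncl_comparison L.fromLam.hom) n) := by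
      apply eq_absHom_fnMap
      · intro a
        apply Subtype.ext
        refine Eq.trans ?_ (toFn_fromLam L _).symm
        refine congrArg L.semiClosed.lam ?_
        -- Weakening a closed element to `n+1` variables directly or through `n` agrees, as there is
        -- only one map out of `Fin 0`.
        refine Eq.trans ?_ (L.theory.map_map (m := n) (l := 0) Fin.elim0 Fin.castSucc a).symm
        exact congrArg (fun f => L.theory.map (m := 0) f a) (funext fun i => i.elim0)
      · intro i
        apply Subtype.ext
        refine Eq.trans ?_ (toFn_fromLam L _).symm
        exact congrArg L.semiClosed.lam (L.theory.map_pr Fin.castSucc i).symm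
      · exact Subtype.ext (idFn_fromLam L n).symm
    exact congrArg Subtype.val (extAlg_hom_congr h t).symm

end Comparison

/-! ### Closed terms and bijectivity of the comparison -/

/-- The evaluation `S_A(0) ⟶ A` of closed terms. -/
noncomputable def evalZero {S : AlgTheory.{u}} (A : Alg S) : S.extAlg A 0 ⟶ A :=
  (ext_free S A A 0 (𝟙 A) Fin.elim0).choose

theorem evalZero_const {S : AlgTheory.{u}} (A : Alg S) (a : A.carrier) :
    (evalZero A).toFun (ExtOp.mk (.const a)) = a :=
  (ext_free S A A 0 (𝟙 A) Fin.elim0).choose_spec.1.1 a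

/-- In arity `0` the constants are the only generators, and evaluating and then reinserting fixes
them. -/
theorem const_evalZero {S : AlgTheory.{u}} (A : Alg S) (x : ExtOp S A 0) :
    ExtOp.mk (.const ((evalZero A).toFun x)) = x := by
  have h : evalZero A ≫ S.extConst A = 𝟙 _ :=
    extAlg_hom_ext (fun a => congrArg (S.extConst A).toFun (evalZero_const A a))
      (fun i => i.elim0)
  exact extAlg_hom_congr h x

/-- This serves both as the base case of bijectivity and as the content of one triangle identity. -/
theorem comparison_zero {S T : AlgTheory.{u}} (F : S ⟶ T)
    (x : ExtOp S (Alg.restrict F (T.freeAlg 0)) 0) :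
    (comparison F).app x = (evalZero _).toFun x := by
  have h : underHom _ (extIncl_comparison F) 0 = evalZero _ := by
    refine extAlg_hom_ext (fun a => ?_) (fun i => i.elim0)
    refine Eq.trans ?_ (evalZero_const _ a).symm
    have e : (Fin.elim0 : Fin 0 → Fin 0) = id := funext fun i => i.elim0
    refine Eq.trans ?_ (T.map_id a)
    exact congrArg (fun f => T.map f a) e
  exact extAlg_hom_congr h x

/-- The inductive step uses only that `λ` is injective with left inverse `ρ` on both sides: equality
is tested after `λ`, and a preimage of `t` is `ρ` of a preimage of `λ t`. -/
theorem comparison_bijective (L : LambdaTheory.{u}) (n : ℕ) :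
    Function.Bijective ((comparison L.fromLam.hom).app (n := n)) := by
  have hp := comparison_preserves L
  induction n with
  | zero =>
    constructor
    · intro x y h
      have h' := (comparison_zero _ x).symm.trans (h.trans (comparison_zero _ y))
      refine (const_evalZero _ x).symm.trans (Eq.trans ?_ (const_evalZero _ y))
      exact congrArg (fun a => ExtOp.mk (.const a)) h'
    · intro a
      exact ⟨ExtOp.mk (.const a), (comparison_zero _ _).trans (evalZero_const (zeroAlg L) a)⟩
  | succ n ih =>
    constructor
    · intro x y h
      have h' := (hp.app_lam x).trans ((congrArg L.semiClosed.lam h).trans (hp.app_lam y).symm)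
      refine ((extSemiClosed (zeroAlg L)).rho_lam x).symm.trans
        (Eq.trans ?_ ((extSemiClosed (zeroAlg L)).rho_lam y))
      exact congrArg (extSemiClosed (zeroAlg L)).rho (ih.1 h')
    · intro t
      obtain ⟨x, hx⟩ := ih.2 (L.semiClosed.lam t)
      refine ⟨(extSemiClosed (zeroAlg L)).rho x, ?_⟩
      rw [hp.app_rho, hx, L.semiClosed.rho_lam]

theorem AlgTheory.exists_inverse {S T : AlgTheory.{u}} (F : S ⟶ T)
    (h : ∀ n, Function.Bijective (F.app (n := n))) :
    ∃ G : T ⟶ S, F ≫ G = 𝟙 S ∧ G ≫ F = 𝟙 T := by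
  choose g hg using fun n t => (h n).2 t
  refine ⟨⟨fun {n} t => g n t, fun f t => (h _).1 ?_, fun i => (h _).1 ?_,
    fun t s => (h _).1 ?_⟩, ?_, ?_⟩
  · rw [hg, F.app_map, hg]
  · rw [hg, F.app_pr]
  · rw [hg, F.app_comp, hg]
    simp only [hg]
  · exact hom_ext fun n t => (h n).1 (hg n _)
  · exact hom_ext fun n t => hg n t

theorem LambdaTheory.isIso_of_bijective {L M : LambdaTheory.{u}} (F : L ⟶ M)
    (h : ∀ n, Function.Bijective (F.hom.app (n := n))) : IsIso F := by
  obtain ⟨G, hFG, hGF⟩ := exists_inverse F.hom h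
  have hG {n : ℕ} (t : M.theory.Op n) : F.hom.app (G.app t) = t :=
    congrArg (fun H : M.theory ⟶ M.theory => H.app t) hGF
  refine ⟨⟨G, ⟨fun t => (h _).1 ?_, fun t => (h _).1 ?_⟩⟩, Hom.ext hFG, Hom.ext hGF⟩
  · rw [hG, F.preserves.app_rho, hG]
  · rw [hG, F.preserves.app_lam, hG]

theorem isTheoryOfExtensions (L : LambdaTheory.{u}) : IsTheoryOfExtensions L.fromLam.hom := by
  obtain ⟨G, h⟩ := exists_inverse (comparison L.fromLam.hom) (comparison_bijective L)
  exact ⟨G, h⟩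

/-! ## The adjoint equivalence -/

/-- The functor `A ↦ Λ_A`. -/
noncomputable abbrev extTheory : LamAlg.{u} ⥤ LambdaTheory.{u} :=
  extFunctor extSemiClosed extSemiClosed_extMap

/-- The comparison `Λ_{L(0)} ⟶ L` as a map of `λ`-theories. -/
noncomputable def comparisonHom (L : LambdaTheory.{u}) : extTheory.obj (atZero.obj L) ⟶ L :=
  ⟨comparison L.fromLam.hom, comparison_preserves L⟩

/-- The comparison as an isomorphism of `λ`-theories. -/
noncomputable def comparisonObjIso (L : LambdaTheory.{u}) : extTheory.obj (atZero.obj L) ≅ L :=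
  have : IsIso (comparisonHom L) :=
    LambdaTheory.isIso_of_bijective _ (comparison_bijective L)
  asIso (comparisonHom L)

theorem comparisonHom_naturality {L M : LambdaTheory.{u}} (F : L ⟶ M) :
    extTheory.map (atZero.map F) ≫ comparisonHom M = comparisonHom L ≫ F := by
  apply LambdaTheory.Hom.ext
  apply hom_ext
  intro n t
  obtain ⟨t, rfl⟩ := ExtOp.exists_rep t
  change comparisonTm M.fromLam.hom (ExtTm.mapConst (atZero.map F) t) =
    F.hom.app (comparisonTm L.fromLam.hom t)
  induction t with
  | var i => exact (F.hom.app_pr i).symm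
  | const a => exact (F.hom.app_map (m := 0) Fin.elim0 a).symm
  | op t x ih =>
    refine Eq.trans ?_ (F.hom.app_comp _ _).symm
    -- Initiality of `Λ`: interpreting in `L` and then applying `F` is interpretation in `M`.
    have h : M.fromLam.hom.app t = F.hom.app (L.fromLam.hom.app t) := by
      rw [← M.eq_fromLam (L.fromLam ≫ F)]
      rfl
    rw [← h]
    exact congrArg (M.theory.comp _) (funext ih)

/-- The natural isomorphism `Λ_{L(0)} ≅ L`. -/
noncomputable def comparisonIso : atZero.{u} ⋙ extTheory ≅ 𝟭 LambdaTheory.{u} :=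
  NatIso.ofComponents (fun L => comparisonObjIso L) comparisonHom_naturality

/-- The evaluation `Λ_A(0) ⟶ A` as a map of `Λ`-algebras. -/
noncomputable def evalHom (A : LamAlg.{u}) : atZero.obj (extTheory.obj A) ⟶ A :=
  -- The identity on elements passes from the action through `fromLam` to the action through
  -- `extIncl`.
  underHom (𝟙 _) ((Category.comp_id _).trans (fromLam_ext A)) 0 ≫ evalZero A

/-- The constants of `Λ_A` as a map of `Λ`-algebras `A ⟶ Λ_A(0)`. -/
noncomputable def evalInv (A : LamAlg.{u}) : A ⟶ atZero.obj (extTheory.obj A) :=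
  Lam.theory.extConst A ≫ underHom (𝟙 _) ((Category.comp_id _).trans (fromLam_ext A).symm) 0

/-- The natural isomorphism `Λ_A(0) ≅ A`. -/
noncomputable def evalIso : extTheory.{u} ⋙ atZero ≅ 𝟭 LamAlg.{u} :=
  -- Naturality is checked for the inclusion of constants, where it holds by definition, and then
  -- inherited by the inverse.
  (NatIso.ofComponents (fun A => ⟨evalInv A, evalHom A,
      Alg.Hom.ext (funext (evalZero_const A)), Alg.Hom.ext (funext (const_evalZero A))⟩)
    (fun _ => rfl)).symm

/-- The constants of `Λ_{Λ_A(0)}` are closed terms of `Λ_A`. One map replaces such a term by the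
constant naming its value, the other weakens it; these agree because a closed term equals the
constant naming its value. -/
theorem extMap_evalHom (A : LamAlg.{u}) :
    extTheory.map (evalHom A) = comparisonHom (extTheory.obj A) := by
  apply LambdaTheory.Hom.ext
  apply hom_ext
  intro n t
  obtain ⟨t, rfl⟩ := ExtOp.exists_rep t
  change ExtOp.mk (ExtTm.mapConst (evalHom A) t) = comparisonTm (extTheory.obj A).fromLam.hom t
  induction t with
  | var i => rfl
  | const a =>
    change ExtOp.mk (.const ((evalZero A).toFun a)) = ExtOp.map Fin.elim0 a
    conv_rhs => rw [← const_evalZero A a]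
    rfl
  | op t x ih =>
    refine (ExtOp.comp_mk (.op t .var) (fun i => ExtTm.mapConst (evalHom A) (x i))).symm.trans ?_
    have h : (extTheory.obj A).fromLam.hom.app t = (Lam.theory.extIncl A).app t := by
      rw [← fromLam_ext A]
      rfl
    exact congrArg₂ (Lam.theory.ext A).comp h.symm (funext ih)

theorem evalHom_atZero (L : LambdaTheory.{u}) :
    atZero.map (comparisonHom L) = evalHom (atZero.obj L) :=
  Alg.Hom.ext (funext (comparison_zero L.fromLam.hom))

/-- The adjunction between `L ↦ L(0)` and `A ↦ Λ_A`. -/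
noncomputable def zeroExtAdj : atZero.{u} ⊣ extTheory :=
  Adjunction.mkOfUnitCounit
    { unit := comparisonIso.inv
      counit := evalIso.hom
      left_triangle := by
        ext L : 2
        -- The counit at `L(0)` is the comparison in arity `0`, so it cancels the image of the unit,
        -- which is the inverse comparison.
        have h : evalIso.hom.app (atZero.obj L) = atZero.map (comparisonIso.hom.app L) :=
          (evalHom_atZero L).symm
        simp [h, ← Functor.map_comp]
      right_triangle := by
        ext A : 2
        have h : extTheory.map (evalIso.hom.app A) = comparisonIso.hom.app (extTheory.obj A) :=
          extMap_evalHom A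
        simp [h] }

end LambdaCalc

theorem mainTheorem1 :
    ∃ (σ : ∀ A : LamAlg.{u}, SemiClosed (Lam.theory.ext A))
      (hσ : ∀ {A B : LamAlg.{u}} (f : A ⟶ B),
        PreservesSemiClosed (σ A) (σ B) (Lam.theory.extMap f))
      (adj : atZero.{u} ⊣ extFunctor σ hσ),
      -- the structure on `Λ_A` extends that of `Λ`
      (∀ A : LamAlg.{u}, PreservesSemiClosed Lam.semiClosed (σ A) (Lam.theory.extIncl A)) ∧
      -- the adjunction is an adjoint equivalence
      IsIso adj.unit ∧ IsIso adj.counit ∧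
      -- `L ≅ Λ_{L(0)}` is inverse to the comparison map `Λ_{L(0)} ⟶ L`
      (∀ L : LambdaTheory.{u},
        (adj.unit.app L).hom ≫ comparison L.fromLam.hom = 𝟙 L.theory) ∧
      -- `Λ_A(0) ≅ A` is inverse to the inclusion of the constants `A ⟶ Λ_A(0)`
      (∀ (A : LamAlg.{u}) (a : A.carrier),
        (adj.counit.app A).toFun ((Lam.theory.extConst A).toFun a) = a) ∧
      -- every `λ`-theory is the theory of extensions of its initial algebra
      (∀ L : LambdaTheory.{u}, IsTheoryOfExtensions L.fromLam.hom) := by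
  refine ⟨extSemiClosed, extSemiClosed_extMap, zeroExtAdj, extSemiClosed_extIncl,
    inferInstanceAs (IsIso comparisonIso.inv), inferInstanceAs (IsIso evalIso.hom),
    fun L => ?_, fun A a => evalZero_const A a, isTheoryOfExtensions⟩
  exact congrArg LambdaTheory.Hom.hom (comparisonIso.inv_hom_id_app L)
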